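/- **Model.** Let $\mathbf Z=(Z_t)_{t\in[0,1]}$ be a random element of $C[0,1]$ with $0\le Z_t\le m$ (a.s.) for some constant $m\ge1$ and $E(Z_t)=1$ for all $t\in[0,1]$. Let $M<0$ and $0<\delta\le 1$, and let $\Theta\subset\mathbb R$ be open with $0\in\Theta$. Let $\{H_\vartheta:\vartheta\in\Theta\}$ be probability distributions on $[0,\infty)$ such that $H_0$ is the uniform distribution on $(0,1)$ and such that, for some $u_0\in(0,1)$, every $H_\vartheta$ has on $[0,u_0]$ a density $$h_\vartheta(u)=1+\vartheta u^\delta+r_\vartheta(u),\qquad r_\vartheta(0)=0,\qquad \sup_{0<|\vartheta|\le\varepsilon_0}\left|\frac{r_\vartheta(u)}{\vartheta u^\delta}\right|\to0\quad(u\downarrow0)$$ for some $\varepsilon_0>0$ (the supremum being over $\vartheta\in\Theta$). Assume $$A:=E\Big(\inf_{t\in[0,1]}Z_t\Big)>0,\qquad\text{and put}\qquad B:=E\Big(\inf_{t\in[0,1]}Z_t^{1+\delta}\Big).$$ Let $(W^{(i)},\mathbf Z^{(i)})$, $i\ge1$, be independent pairs such that, under $P_\vartheta$, $W^{(i)}$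 and $\mathbf Z^{(i)}$ are independent, $W^{(i)}\sim H_\vartheta$, and $\mathbf Z^{(i)}$ is distributed as $\mathbf Z$. Put $X^{(i)}_t:=\max(-W^{(i)}/Z^{(i)}_t,M)$, with $X^{(i)}_t:=M$ where $Z^{(i)}_t=0$. For $n\in\mathbb N$ and $c<0$ let $$N_{n,c}(D):=\sum_{i\le n}\varepsilon_{\sup_t(X^{(i)}_t/c)}(D\cap[0,1]),\qquad D\subset\mathbb R\ \text{Borel},$$ be the point process of exceedances, where $\varepsilon_x$ is the unit point mass at $x$. Let $Y_1,\dots,Y_{\tau(n)}$ be those among the values $\sup_t(X_t^{(i)}/c)$, $i\le n$, which are $\le1$, in the order of their outcome. Let $$L_{n,c}(\vartheta\mid0):=\log\frac{d\mathcal L_\vartheta(N_{n,c})}{d\mathcal L_0(N_{n,c})}(N_{n,c})$$ be the log-likelihood ratio, where $\mathcal L_\vartheta(N_{n,c})$ is the distribution of $N_{n,c}$ under $P_\vartheta$. **Theorem.** Let $c_n<0$ with $c_n\to0$ and $n|c_n|^{1+2\delta}\to\infty$, let $\xi\in\mathbb R$, and put $\vartheta_n:=\xi/(n|c_n|^{1+2\delta})^{1/2}$.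 With $c=c_n$ in the definition of $\tau(n)$ and $Y_k$, set $$Z_{n1}:=\frac{\tau(n)-n|c_n|A}{(n|c_n|A)^{1/2}},\qquad Z_{n2}:=\frac{1+\delta}{\tau(n)^{1/2}}\sum_{k\le\tau(n)}\Big(Y_k^\delta-\frac1{1+\delta}\Big),$$ where $Z_{n2}:=0$ if $\tau(n)=0$. Then, for all large $n$, $\vartheta_n\in\Theta$ and $\mathcal L_{\vartheta_n}(N_{n,c_n})$ is dominated by $\mathcal L_0(N_{n,c_n})$. Moreover, $$L_{n,c_n}(\vartheta_n\mid0)=\frac{\xi B}{(1+\delta)A^{1/2}}(Z_{n1}+Z_{n2})-\frac{\xi^2B^2}{2A(2\delta+1)}+o_{P_0}(1),$$ and, under $P_0$, as $n\to\infty$, $$L_{n,c_n}(\vartheta_n\mid0)\to_D N\Big(-\frac{\xi^2B^2}{2A(2\delta+1)},\frac{\xi^2B^2}{A(2\delta+1)}\Big),$$ $$Z_{n1}\to_D N(0,1),\qquad Z_{n2}\to_D N\Big(0,\frac{\delta^2}{2\delta+1}\Big).$$ Finally, $Z_{n1}$ and $Z_{n2}$ are asymptotically independent: under $P_0$, $$(Z_{n1},Z_{n2})\to_D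 N(0,1)\otimes N\Big(0,\frac{\delta^2}{2\delta+1}\Big).$$ -/

import Mathlib

open MeasureTheory ProbabilityTheory Filter Topology Set

noncomputable section

namespace GPPTest

/-- The space `C[0,1]` of sample paths carries its Borel σ-field (sup-norm topology). -/
instance : MeasurableSpace C(unitInterval, ℝ) := borel _

instance : BorelSpace C(unitInterval, ℝ) := ⟨rfl⟩

/-- `Q` is the distribution of a generator: a process in `C[0,1]` with `0 ≤ Z_t ≤ m` for some
constant `m ≥ 1` and `E Z_t = 1` for every `t`. -/
structure IsGeneratorLaw (Q : Measure C(unitInterval, ℝ)) : Prop where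
  isProbabilityMeasure : IsProbabilityMeasure Q
  bounded : ∃ m : ℝ, 1 ≤ m ∧ ∀ᵐ z ∂Q, ∀ t, 0 ≤ z t ∧ z t ≤ m
  mean_eq_one : ∀ t, ∫ z, z t ∂Q = 1

/-- `A = E (inf_t Z_t)`. -/
def constA (Q : Measure C(unitInterval, ℝ)) : ℝ := ∫ z, ⨅ t, z t ∂Q

/-- `B = E (inf_t Z_t ^ (1 + δ))`. -/
def constB (Q : Measure C(unitInterval, ℝ)) (δ : ℝ) : ℝ := ∫ z, ⨅ t, (z t) ^ (1 + δ) ∂Q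

/-- The family of distributions `H ϑ`, `ϑ ∈ Θ`, of the variable `W ≥ 0`: `Θ` is an open set
containing `0`, `H 0` is the uniform distribution on `(0,1)`, and on a fixed interval `[0, u₀]`
the distribution `H ϑ` has a density `h ϑ` such that the remainder
`r ϑ u = h ϑ u - 1 - ϑ * u ^ δ` satisfies `r ϑ 0 = 0` and
`sup_{0 < |ϑ| ≤ ε₀} |r ϑ u / (ϑ * u ^ δ)| → 0` as `u ↓ 0`. -/
structure IsDeltaFamily (δ : ℝ) (Θ : Set ℝ) (H : ℝ → Measure ℝ) : Prop where
  delta_pos : 0 < δ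
  delta_le_one : δ ≤ 1
  isOpen : IsOpen Θ
  zero_mem : (0 : ℝ) ∈ Θ
  isProbabilityMeasure : ∀ ϑ ∈ Θ, IsProbabilityMeasure (H ϑ)
  nonneg : ∀ ϑ ∈ Θ, H ϑ (Iio 0) = 0
  uniform : H 0 = (volume : Measure ℝ).restrict (Ioo 0 1)
  density : ∃ (h : ℝ → ℝ → ℝ) (u₀ ε₀ : ℝ), 0 < u₀ ∧ u₀ < 1 ∧ 0 < ε₀ ∧
    (∀ ϑ ∈ Θ, Measurable (h ϑ) ∧ (∀ u ∈ Icc 0 u₀, 0 ≤ h ϑ u) ∧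
      (H ϑ).restrict (Icc 0 u₀) =
        ((volume : Measure ℝ).restrict (Icc 0 u₀)).withDensity (fun u => ENNReal.ofReal (h ϑ u)) ∧
      h ϑ 0 - 1 - ϑ * (0 : ℝ) ^ δ = 0) ∧
    TendstoUniformlyOn (fun u ϑ => (h ϑ u - 1 - ϑ * u ^ δ) / (ϑ * u ^ δ)) (fun _ => 0)
      (𝓝[>] 0) {ϑ | ϑ ∈ Θ ∧ 0 < |ϑ| ∧ |ϑ| ≤ ε₀}

/-- The process `X_t = max (-W / Z_t) M`, for `W = w`, `Z = z`. Where `Z_t = 0` the quotient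
`-W / Z_t` is read as `-∞`, so that `X_t = M` there. -/
def pathX (M w : ℝ) (z : C(unitInterval, ℝ)) (t : unitInterval) : ℝ :=
  if z t = 0 then M else max (-w / z t) M

/-- `sup_t (X_t / c)`. -/
def supX (M c w : ℝ) (z : C(unitInterval, ℝ)) : ℝ := ⨆ t, pathX M w z t / c

variable {Ω : Type*} [MeasurableSpace Ω]

/-- The statistical model: under `P ϑ` the pairs `(W i, Z i)`, `i = 0, 1, …`, are independent, and
for each `i` the variable `W i` has distribution `H ϑ`, the process `Z i` has distribution `Q`, and
they are independent of each other. -/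
structure IsSample (Θ : Set ℝ) (H : ℝ → Measure ℝ) (Q : Measure C(unitInterval, ℝ))
    (P : ℝ → Measure Ω) (W : ℕ → Ω → ℝ) (Z : ℕ → Ω → C(unitInterval, ℝ)) : Prop where
  measurable_W : ∀ i, Measurable (W i)
  measurable_Z : ∀ i, Measurable (Z i)
  iIndepFun : ∀ ϑ ∈ Θ, iIndepFun (fun i ω => (W i ω, Z i ω)) (P ϑ)
  indepFun : ∀ ϑ ∈ Θ, ∀ i, IndepFun (W i) (Z i) (P ϑ)
  law_W : ∀ ϑ ∈ Θ, ∀ i, (P ϑ).map (W i) = H ϑ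
  law_Z : ∀ ϑ ∈ Θ, ∀ i, (P ϑ).map (Z i) = Q

/-- The point process of exceedances among the first `n` observations,
`N_{n,c}(D) = ∑_{i < n} ε_{sup_t (X_t^{(i)} / c)} (D ∩ [0,1])`. -/
def pointProcess (M : ℝ) (W : ℕ → Ω → ℝ) (Z : ℕ → Ω → C(unitInterval, ℝ)) (n : ℕ) (c : ℝ)
    (ω : Ω) : Measure ℝ :=
  ∑ i ∈ Finset.range n, (Measure.dirac (supX M c (W i ω) (Z i ω))).restrict (Icc 0 1)

/-- The distribution of `N_{n,c}` under `P`, a measure on the space of measures on `ℝ` (with the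
σ-field generated by the evaluations). -/
def pointProcessLaw (P : Measure Ω) (M : ℝ) (W : ℕ → Ω → ℝ) (Z : ℕ → Ω → C(unitInterval, ℝ))
    (n : ℕ) (c : ℝ) : Measure (Measure ℝ) :=
  P.map (pointProcess M W Z n c)

/-- The log-likelihood ratio `L_{n,c}(ϑ | 0)`: the logarithm of the Radon-Nikodym derivative of the
law of `N_{n,c}` under `ϑ` with respect to its law under `0`, evaluated at `N_{n,c}`. -/
def logLR (P : ℝ → Measure Ω) (M : ℝ) (W : ℕ → Ω → ℝ) (Z : ℕ → Ω → C(unitInterval, ℝ))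
    (n : ℕ) (c ϑ : ℝ) (ω : Ω) : ℝ :=
  llr (pointProcessLaw (P ϑ) M W Z n c) (pointProcessLaw (P 0) M W Z n c)
    (pointProcess M W Z n c ω)

/-- The list `Y_1, …, Y_{τ(n)}` of those values `sup_t (X_t^{(i)} / c)`, `i < n`, that are `≤ 1`, in
the order of their outcome. -/
def exceedances (M : ℝ) (W : ℕ → Ω → ℝ) (Z : ℕ → Ω → C(unitInterval, ℝ)) (n : ℕ) (c : ℝ)
    (ω : Ω) : List ℝ :=
  ((List.range n).map (fun i => supX M c (W i ω) (Z i ω))).filter (fun y => y ≤ 1)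

/-- `τ(n)`, the number of exceedances. -/
def numExc (M : ℝ) (W : ℕ → Ω → ℝ) (Z : ℕ → Ω → C(unitInterval, ℝ)) (n : ℕ) (c : ℝ)
    (ω : Ω) : ℕ :=
  (exceedances M W Z n c ω).length

/-- `Z_{n1} = (τ(n) - n |c| A) / (n |c| A) ^ (1/2)`. -/
def statZ1 (Q : Measure C(unitInterval, ℝ)) (M : ℝ) (W : ℕ → Ω → ℝ)
    (Z : ℕ → Ω → C(unitInterval, ℝ)) (n : ℕ) (c : ℝ) (ω : Ω) : ℝ :=
  (numExc M W Z n c ω - n * |c| * constA Q) / √(n * |c| * constA Q)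

/-- `Z_{n2} = (1 + δ) / τ(n) ^ (1/2) * ∑_{k ≤ τ(n)} (Y_k ^ δ - 1 / (1 + δ))`
(with value `0` if there is no exceedance). -/
def statZ2 (δ M : ℝ) (W : ℕ → Ω → ℝ) (Z : ℕ → Ω → C(unitInterval, ℝ)) (n : ℕ) (c : ℝ)
    (ω : Ω) : ℝ :=
  (1 + δ) / √(numExc M W Z n c ω) *
    ((exceedances M W Z n c ω).map (fun y => y ^ δ - 1 / (1 + δ))).sum

/-- The alternatives `ϑ_n = ξ / (n |c_n| ^ (1 + 2 δ)) ^ (1/2)`. -/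
def altSeq (δ ξ : ℝ) (c : ℕ → ℝ) (n : ℕ) : ℝ := ξ / √(n * |c n| ^ (1 + 2 * δ))

end GPPTest

end

/-! Write `I` for the minimum of the path `Z`. Dividing by `c < 0` turns the supremum of `X_t / c`
into the minimum of `W / I` and `|M|`, divided by `|c|` (`supX_eq_obs`), so the functional model
reduces to i.i.d. real observations. Conditioning on `Z` and rescaling (`restrict_map_obs`), such an
observation has density `|c| A (1 + x(v))` on `[0,1]`, where `x` vanishes for `ϑ = 0` and `x(v) ≈ η
b v^δ` with `η = ϑ |c|^δ` and `b = B / A` (`abs_relDens_sub_le`). Under `P 0` the exceedances are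
therefore uniform, each occurring with probability `p = |c| A`.

The point process does not see values outside `[0,1]`. Collapsing these to one atom makes the laws
comparable even where the distributions `H ϑ` are arbitrary, and the likelihood ratio becomes a
product: a factor `1 + x(Y_k)` for every exceedance and a factor `1 - q`, `q = p / (1 - p) * ∫ x`,
for each of the other `n - τ` observations (`map_pointMeasure_eq_withDensity`).

For `ϑ = ϑ_n` the quantity `η² n p` equals `κ = ξ² A`. Expanding both logarithms
(`IsUniformArray.tendstoInMeasure_logDens`), the linear terms combine to `η b (∑ Y_k^δ - n p / (1 +
δ))`, the quadratic term concentrates at `κ b² / (2 (2 δ + 1))`, and everything else is negligible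
by first and second moment bounds. Splitting `Y_k^δ` into its mean `1 / (1 + δ)` and its fluctuation
yields a multiple of `Z_{n1} + Z_{n2}`.

The fluctuation has mean zero under the uniform law, hence the count and the centred power sum are
uncorrelated. A bivariate central limit theorem proved with characteristic functions gives the
product Gaussian limit (`IsUniformArray.tendstoInDistribution_pair`). Normalizing by `τ` instead of
`n p` costs only a term vanishing in probability (`IsUniformArray.tendstoInMeasure_renormalize`),
and the limit of the log-likelihood ratio follows by continuous mapping and Slutsky. -/

namespace GPPTest

/-! ### Moment bounds, a central limit theorem for arrays, convergence in probability -/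

variable {Ω : Type*} [MeasurableSpace Ω]

/-- Second moment bound for centred sums of i.i.d. bounded variables. -/
theorem integral_sq_sum_sub_le {P : Measure Ω} [IsProbabilityMeasure P] {V : ℕ → Ω → ℝ}
    (hV : ∀ i, Measurable (V i)) (hind : iIndepFun V P) {ν : Measure ℝ}
    (hν : ∀ i, P.map (V i) = ν) {φ : ℝ → ℝ} (hφ : Measurable φ) {C : ℝ} (hC : ∀ x, |φ x| ≤ C)
    (n : ℕ) :
    ∫ ω, (∑ i ∈ Finset.range n, φ (V i ω) - n * ∫ x, φ x ∂ν) ^ 2 ∂P ≤ n * ∫ x, φ x ^ 2 ∂ν := by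
  have hmem : ∀ i, MemLp (fun ω => φ (V i ω)) 2 P := fun i =>
    MemLp.of_bound (hφ.comp (hV i)).aestronglyMeasurable C (ae_of_all _ fun ω => hC _)
  have hint : ∀ i, ∫ ω, φ (V i ω) ∂P = ∫ x, φ x ∂ν := fun i => by
    rw [← hν i, integral_map (hV i).aemeasurable hφ.aestronglyMeasurable]
  have hint2 : ∀ i, ∫ ω, φ (V i ω) ^ 2 ∂P = ∫ x, φ x ^ 2 ∂ν := fun i => by
    rw [← hν i, integral_map (hV i).aemeasurable (hφ.pow_const 2).aestronglyMeasurable]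
  have hmean : ∫ ω, (∑ i ∈ Finset.range n, fun ω => φ (V i ω)) ω ∂P = n * ∫ x, φ x ∂ν := by
    simp only [Finset.sum_apply]
    rw [integral_finsetSum _ fun i _ => (hmem i).integrable (by norm_num)]
    simp [hint]
  have hvar : variance (∑ i ∈ Finset.range n, fun ω => φ (V i ω)) P
      = ∑ i ∈ Finset.range n, variance (fun ω => φ (V i ω)) P := by
    refine IndepFun.variance_sum (fun i _ => hmem i) fun i _ j _ hij => ?_
    exact (hind.indepFun hij).comp hφ hφ
  have hle : ∀ i, variance (fun ω => φ (V i ω)) P ≤ ∫ x, φ x ^ 2 ∂ν := fun i => by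
    refine (variance_le_expectation_sq (hmem i).1).trans (le_of_eq ?_)
    rw [← hint2 i]; rfl
  rw [variance_eq_integral (by fun_prop), hmean] at hvar
  simp only [Finset.sum_apply] at hvar
  rw [hvar]
  refine (Finset.sum_le_sum fun i _ => hle i).trans ?_
  simp

theorem norm_exp_mul_I_sub_taylor_le (x : ℝ) (hx : |x| ≤ 1) :
    ‖Complex.exp (x * Complex.I) - (1 + x * Complex.I - (x ^ 2 / 2 : ℝ))‖ ≤ |x| ^ 3 := by
  have h := Complex.exp_bound (x := x * Complex.I) (by simpa using hx) (n := 3) (by norm_num)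
  have h2 : ‖(x * Complex.I : ℂ)‖ = |x| := by simp
  rw [h2] at h
  have h3 : (∑ m ∈ Finset.range 3, ((x : ℂ) * Complex.I) ^ m / (m.factorial : ℂ))
      = 1 + x * Complex.I - (x ^ 2 / 2 : ℝ) := by
    simp [Finset.sum_range_succ, mul_pow]
    ring
  rw [h3] at h
  refine h.trans ?_
  have : 0 ≤ |x| ^ 3 := by positivity
  norm_num [Nat.factorial]
  nlinarith

/-- Powers of characteristic functions of uniformly small centred variables. -/
theorem tendsto_integral_cexp_pow {ν : ℕ → Measure ℝ} [∀ n, IsProbabilityMeasure (ν n)]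
    {φ : ℕ → ℝ → ℝ} (hφ : ∀ n, Measurable (φ n)) {K : ℕ → ℝ} (hb : ∀ n x, |φ n x| ≤ K n)
    (hK : Tendsto K atTop (𝓝 0)) (h0 : ∀ᶠ n in atTop, ∫ x, φ n x ∂ν n = 0) {s : ℝ}
    (h2 : Tendsto (fun n : ℕ => n * ∫ x, φ n x ^ 2 ∂ν n) atTop (𝓝 s)) :
    Tendsto (fun n : ℕ => (∫ x, Complex.exp (φ n x * Complex.I) ∂ν n) ^ n) atTop
      (𝓝 (Complex.exp (-(s / 2 : ℝ)))) := by
  -- The mean is zero, so the expansion of the characteristic function begins with the second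
  -- moment. The cubic remainder is at most `K n * φ²`, which stays negligible after multiplication
  -- by `n`.
  have key : Tendsto (fun n : ℕ => (n : ℂ) * (∫ x, Complex.exp (φ n x * Complex.I) ∂ν n - 1)) atTop
      (𝓝 (-(s / 2 : ℝ))) := by
    have hbd : ∀ᶠ n : ℕ in atTop,
        ‖(n : ℂ) * (∫ x, Complex.exp (φ n x * Complex.I) ∂ν n - 1)
          + ((n * ∫ x, φ n x ^ 2 ∂ν n) / 2 : ℝ)‖ ≤ K n * (n * ∫ x, φ n x ^ 2 ∂ν n) := by
      filter_upwards [h0, hK.eventually_le_const zero_lt_one] with n hn hK1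
      have i1 : Integrable (φ n) (ν n) :=
        Integrable.of_bound (hφ n).aestronglyMeasurable (K n) (ae_of_all _ (hb n))
      have i2 : Integrable (fun x => φ n x ^ 2) (ν n) := by
        refine Integrable.of_bound ((hφ n).pow_const 2).aestronglyMeasurable (K n ^ 2)
          (ae_of_all _ fun x => ?_)
        simpa using pow_le_pow_left₀ (abs_nonneg _) (hb n x) 2
      have i3 : Integrable (fun x => Complex.exp (φ n x * Complex.I)) (ν n) := by
        refine Integrable.of_bound (Measurable.aestronglyMeasurable ?_) 1
          (ae_of_all _ fun x => by simp)
        have := hφ n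
        fun_prop
      have i4 : Integrable (fun x => (1 + φ n x * Complex.I - (φ n x ^ 2 / 2 : ℝ) : ℂ)) (ν n) := by
        refine ((integrable_const (1 : ℂ)).add (i1.ofReal.mul_const Complex.I)).sub ?_
        exact (i2.div_const 2).ofReal
      have e : ∫ x, (1 + φ n x * Complex.I - (φ n x ^ 2 / 2 : ℝ) : ℂ) ∂ν n
          = 1 - ((∫ x, φ n x ^ 2 ∂ν n) / 2 : ℝ) := by
        have k1 : Integrable (fun x => (φ n x * Complex.I : ℂ)) (ν n) := i1.ofReal.mul_const _
        have k2 : Integrable (fun x => (1 + φ n x * Complex.I : ℂ)) (ν n) :=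
          (integrable_const (1 : ℂ)).add k1
        have k3 : Integrable (fun x => ((φ n x ^ 2 / 2 : ℝ) : ℂ)) (ν n) :=
          (i2.div_const 2).ofReal
        rw [integral_sub k2 k3, integral_add (integrable_const (1 : ℂ)) k1, integral_mul_const, integral_complex_ofReal, hn,
          integral_complex_ofReal, integral_div]
        simp
      have e2 : (n : ℂ) * (∫ x, Complex.exp (φ n x * Complex.I) ∂ν n - 1)
          + ((n * ∫ x, φ n x ^ 2 ∂ν n) / 2 : ℝ)
          = n * ∫ x, (Complex.exp (φ n x * Complex.I)
            - (1 + φ n x * Complex.I - (φ n x ^ 2 / 2 : ℝ))) ∂ν n := by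
        rw [integral_sub i3 i4, e]; push_cast; ring
      rw [e2, norm_mul, Complex.norm_natCast]
      have : ‖∫ x, (Complex.exp (φ n x * Complex.I)
            - (1 + φ n x * Complex.I - (φ n x ^ 2 / 2 : ℝ))) ∂ν n‖
          ≤ K n * ∫ x, φ n x ^ 2 ∂ν n := by
        rw [← integral_const_mul]
        refine norm_integral_le_of_norm_le (i2.const_mul _) (ae_of_all _ fun x => ?_)
        refine (norm_exp_mul_I_sub_taylor_le _ ((hb n x).trans hK1)).trans ?_
        rw [pow_succ', sq_abs]
        exact mul_le_mul_of_nonneg_right (hb n x) (sq_nonneg _)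
      calc _ ≤ (n : ℝ) * (K n * ∫ x, φ n x ^ 2 ∂ν n) := by gcongr
        _ = _ := by ring
    have hz : Tendsto (fun n : ℕ => K n * (n * ∫ x, φ n x ^ 2 ∂ν n)) atTop (𝓝 0) := by
      simpa using hK.mul h2
    have h3 := squeeze_zero_norm' hbd hz
    have h4 : Tendsto (fun n : ℕ => (((n * ∫ x, φ n x ^ 2 ∂ν n) / 2 : ℝ) : ℂ)) atTop
        (𝓝 ((s / 2 : ℝ) : ℂ)) := (Complex.continuous_ofReal.tendsto _).comp (h2.div_const 2)
    simpa using h3.sub h4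
  simpa using Complex.tendsto_one_add_pow_exp_of_tendsto key

/-- Bivariate central limit theorem for row-wise i.i.d. arrays of uniformly small variables whose
two components are asymptotically uncorrelated. -/
theorem tendstoInDistribution_row_sums {P : Measure Ω} [IsProbabilityMeasure P]
    {V : ℕ → ℕ → Ω → ℝ} (hV : ∀ n i, Measurable (V n i)) (hind : ∀ n, iIndepFun (V n) P)
    {ν : ℕ → Measure ℝ} (hν : ∀ n i, P.map (V n i) = ν n) {φ ψ : ℕ → ℝ → ℝ}
    (hφ : ∀ n, Measurable (φ n)) (hψ : ∀ n, Measurable (ψ n)) {K : ℕ → ℝ}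
    (hbφ : ∀ n x, |φ n x| ≤ K n) (hbψ : ∀ n x, |ψ n x| ≤ K n) (hK : Tendsto K atTop (𝓝 0))
    (h0φ : ∀ᶠ n in atTop, ∫ x, φ n x ∂ν n = 0) (h0ψ : ∀ᶠ n in atTop, ∫ x, ψ n x ∂ν n = 0)
    {a b : NNReal} (h2φ : Tendsto (fun n : ℕ => n * ∫ x, φ n x ^ 2 ∂ν n) atTop (𝓝 a))
    (h2ψ : Tendsto (fun n : ℕ => n * ∫ x, ψ n x ^ 2 ∂ν n) atTop (𝓝 b))
    (hφψ : Tendsto (fun n : ℕ => n * ∫ x, φ n x * ψ n x ∂ν n) atTop (𝓝 0)) :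
    TendstoInDistribution (fun n ω => (∑ i ∈ Finset.range n, φ n (V n i ω),
        ∑ i ∈ Finset.range n, ψ n (V n i ω))) atTop id (fun _ => P)
      ((gaussianReal 0 a).prod (gaussianReal 0 b)) := by
  have hprob : ∀ n, IsProbabilityMeasure (ν n) := fun n => by
    rw [← hν n 0]; exact Measure.isProbabilityMeasure_map (hV n 0).aemeasurable
  have hm : ∀ n, Measurable (fun ω => (∑ i ∈ Finset.range n, φ n (V n i ω),
        ∑ i ∈ Finset.range n, ψ n (V n i ω))) := fun n => by
    have := hφ n; have := hψ n; have := hV n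
    fun_prop
  -- Characteristic functions require an inner product, hence the passage to the `L²` product; the
  -- continuous map `WithLp.ofLp` undoes it at the end.
  have main : TendstoInDistribution (fun n ω => WithLp.toLp 2 (∑ i ∈ Finset.range n, φ n (V n i ω),
        ∑ i ∈ Finset.range n, ψ n (V n i ω))) atTop (WithLp.toLp 2) (fun _ => P)
      ((gaussianReal 0 a).prod (gaussianReal 0 b)) := by
    refine ⟨fun n => ?_, by fun_prop, ?_⟩
    · have := hm n; fun_prop
    refine ProbabilityMeasure.tendsto_iff_tendsto_charFun.2 fun t ↦ ?_
    obtain ⟨u, v⟩ := t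
    simp only [ProbabilityMeasure.coe_mk]
    rw [charFun_prod, charFun_gaussianReal, charFun_gaussianReal]
    have hlin : ∀ n, Measurable (fun x => u * φ n x + v * ψ n x) := fun n => by
      have := hφ n; have := hψ n; fun_prop
    have hb : ∀ n x, |u * φ n x + v * ψ n x| ≤ (|u| + |v|) * K n := fun n x => by
      calc _ ≤ |u * φ n x| + |v * ψ n x| := abs_add_le _ _
        _ = |u| * |φ n x| + |v| * |ψ n x| := by rw [abs_mul, abs_mul]
        _ ≤ |u| * K n + |v| * K n := by gcongr; exacts [hbφ n x, hbψ n x]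
        _ = _ := by ring
    have iφ : ∀ n, MemLp (φ n) 2 (ν n) := fun n =>
      MemLp.of_bound (hφ n).aestronglyMeasurable (K n) (ae_of_all _ (hbφ n))
    have iψ : ∀ n, MemLp (ψ n) 2 (ν n) := fun n =>
      MemLp.of_bound (hψ n).aestronglyMeasurable (K n) (ae_of_all _ (hbψ n))
    -- For fixed `(u, v)` the combination `u φ + v ψ` is one small centred array. Its limiting
    -- variance is `u² a + v² b` because the cross moment disappears, and this is what makes the
    -- limit a product.
    have key := tendsto_integral_cexp_pow (ν := ν) hlin hb (by simpa using hK.const_mul (|u| + |v|))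
      (s := u ^ 2 * a + v ^ 2 * b) (by
        filter_upwards [h0φ, h0ψ] with n h1 h2
        rw [integral_add (((iφ n).integrable (by norm_num)).const_mul u)
          (((iψ n).integrable (by norm_num)).const_mul v), integral_const_mul, integral_const_mul,
          h1, h2]
        simp) (by
        have : ∀ n : ℕ, n * ∫ x, (u * φ n x + v * ψ n x) ^ 2 ∂ν n
            = u ^ 2 * (n * ∫ x, φ n x ^ 2 ∂ν n) + v ^ 2 * (n * ∫ x, ψ n x ^ 2 ∂ν n)
              + 2 * u * v * (n * ∫ x, φ n x * ψ n x ∂ν n) := fun n => by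
          have e : ∀ x, (u * φ n x + v * ψ n x) ^ 2
            = u ^ 2 * φ n x ^ 2 + v ^ 2 * ψ n x ^ 2 + 2 * u * v * (φ n x * ψ n x) := fun x => by ring
          simp_rw [e]
          have j1 := (iφ n).integrable_sq
          have j2 := (iψ n).integrable_sq
          have j3 : Integrable (fun x => φ n x * ψ n x) (ν n) := (iφ n).integrable_mul (iψ n)
          have k : Integrable (fun x => u ^ 2 * φ n x ^ 2 + v ^ 2 * ψ n x ^ 2) (ν n) :=
            (j1.const_mul _).add (j2.const_mul _)
          rw [integral_add k (j3.const_mul _), integral_add (j1.const_mul _) (j2.const_mul _)]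
          simp only [integral_const_mul]
          ring
        simp_rw [this]
        simpa using ((h2φ.const_mul (u ^ 2)).add (h2ψ.const_mul (v ^ 2))).add
          (hφψ.const_mul (2 * u * v)))
    have elim : Complex.exp (-((u ^ 2 * a + v ^ 2 * b) / 2 : ℝ))
        = Complex.exp (u * (0 : ℝ) * Complex.I - (a : ℝ) * u ^ 2 / 2)
          * Complex.exp (v * (0 : ℝ) * Complex.I - (b : ℝ) * v ^ 2 / 2) := by
      rw [← Complex.exp_add]; push_cast; ring_nf
    simp only at elim ⊢
    rw [← elim]
    refine key.congr fun n => ?_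
    have hindn : iIndepFun (fun i : Fin n => V n i) P := (hind n).precomp Fin.val_injective
    have hcexp : Measurable fun x => Complex.exp ((u * φ n x + v * ψ n x : ℝ) * Complex.I) := by
      have := hlin n; fun_prop
    have hp := hindn.integral_fun_prod_comp (fun i => (hV n i).aemeasurable)
      (f := fun _ x => Complex.exp ((u * φ n x + v * ψ n x : ℝ) * Complex.I))
      (fun i => hcexp.aestronglyMeasurable)
    have hsingle : ∀ i : Fin n,
        ∫ ω, Complex.exp ((u * φ n (V n i ω) + v * ψ n (V n i ω) : ℝ) * Complex.I) ∂P
          = ∫ x, Complex.exp ((u * φ n x + v * ψ n x : ℝ) * Complex.I) ∂ν n := fun i => by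
      rw [← hν n i, integral_map (hV n i).aemeasurable hcexp.aestronglyMeasurable]
    simp only [hsingle, Finset.prod_const, Finset.card_univ, Fintype.card_fin] at hp
    have := hm n
    rw [← hp, charFun_apply, integral_map (by fun_prop)
      (Measurable.aestronglyMeasurable (by fun_prop))]
    refine integral_congr_ae (ae_of_all _ fun ω => ?_)
    beta_reduce
    rw [← Complex.exp_sum, ← Finset.sum_mul]
    simp only [WithLp.prod_inner_apply, RCLike.inner_apply, conj_trivial]
    rw [← Finset.sum_range (fun i => ((u * φ n (V n i ω) + v * ψ n (V n i ω) : ℝ) : ℂ)),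
      ← Complex.ofReal_sum, Finset.sum_add_distrib, Finset.mul_sum, Finset.mul_sum]
  have := main.continuous_comp (g := WithLp.ofLp) (by fun_prop)
  exact this

theorem tendstoInMeasure_zero_add {P : Measure Ω} {f g : ℕ → Ω → ℝ}
    (hf : TendstoInMeasure P f atTop fun _ => 0) (hg : TendstoInMeasure P g atTop fun _ => 0) :
    TendstoInMeasure P (fun n ω => f n ω + g n ω) atTop fun _ => 0 := by
  rw [tendstoInMeasure_iff_norm] at hf hg ⊢
  intro ε hε
  have h := (hf (ε / 2) (half_pos hε)).add (hg (ε / 2) (half_pos hε))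
  rw [add_zero] at h
  refine tendsto_of_tendsto_of_tendsto_of_le_of_le tendsto_const_nhds h (fun _ => zero_le)
    fun n => (measure_mono fun ω hω => ?_).trans (measure_union_le _ _)
  simp only [mem_ofPred_eq, sub_zero, mem_union] at hω ⊢
  by_contra! hc
  linarith [norm_add_le (f n ω) (g n ω), hc.1, hc.2]

theorem tendstoInMeasure_zero_of_le {P : Measure Ω} {f g : ℕ → Ω → ℝ} {E : ℕ → Set Ω}
    (hE : Tendsto (fun n => P (E n)) atTop (𝓝 0))
    (hg : TendstoInMeasure P g atTop fun _ => 0)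
    (hle : ∀ᶠ n in atTop, ∀ᵐ ω ∂P, ω ∉ E n → |f n ω| ≤ |g n ω|) :
    TendstoInMeasure P f atTop fun _ => 0 := by
  rw [tendstoInMeasure_iff_norm] at hg ⊢
  intro ε hε
  have h := hE.add (hg ε hε)
  rw [add_zero] at h
  refine tendsto_of_tendsto_of_tendsto_of_le_of_le' tendsto_const_nhds h
    (Eventually.of_forall fun _ => zero_le) ?_
  filter_upwards [hle] with n hn
  refine (measure_mono_ae ?_).trans (measure_union_le _ _)
  filter_upwards [hn] with ω hω hωε
  by_cases hc : ω ∈ E n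
  · exact Or.inl hc
  · have h1 : ε ≤ ‖f n ω - 0‖ := hωε
    rw [sub_zero, Real.norm_eq_abs] at h1
    refine Or.inr (show ε ≤ ‖g n ω - 0‖ from ?_)
    rw [sub_zero, Real.norm_eq_abs]
    exact h1.trans (hω hc)

theorem tendsto_measure_ge_of_integral_le {P : Measure Ω} [IsProbabilityMeasure P]
    {g : ℕ → Ω → ℝ} {b : ℕ → ℝ} (h0 : ∀ᶠ n in atTop, ∀ᵐ ω ∂P, 0 ≤ g n ω)
    (hint : ∀ᶠ n in atTop, Integrable (g n) P) (hb : ∀ᶠ n in atTop, ∫ ω, g n ω ∂P ≤ b n)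
    (hb0 : Tendsto b atTop (𝓝 0)) {ε : ℝ} (hε : 0 < ε) :
    Tendsto (fun n => P {ω | ε ≤ g n ω}) atTop (𝓝 0) := by
  rw [← ENNReal.tendsto_toReal_iff (by simp) (by simp)]
  have h : Tendsto (fun n => b n / ε) atTop (𝓝 0) := by simpa using hb0.div_const ε
  refine squeeze_zero' (Eventually.of_forall fun _ => ENNReal.toReal_nonneg) ?_ h
  filter_upwards [h0, hint, hb] with n h1 h2 h3
  rw [le_div_iff₀ hε, mul_comm]
  exact (mul_meas_ge_le_integral_of_nonneg h1 h2 ε).trans h3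

theorem tendstoInMeasure_zero_of_integral_le {P : Measure Ω} [IsProbabilityMeasure P]
    {f g : ℕ → Ω → ℝ} {b : ℕ → ℝ} (hle : ∀ᶠ n in atTop, ∀ᵐ ω ∂P, |f n ω| ≤ g n ω)
    (hint : ∀ᶠ n in atTop, Integrable (g n) P) (hb : ∀ᶠ n in atTop, ∫ ω, g n ω ∂P ≤ b n)
    (hb0 : Tendsto b atTop (𝓝 0)) : TendstoInMeasure P f atTop fun _ => 0 := by
  rw [tendstoInMeasure_iff_norm]
  intro ε hε
  have h := tendsto_measure_ge_of_integral_le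
    (hle.mono fun n hn => hn.mono fun ω hω => (abs_nonneg _).trans hω) hint hb hb0 hε
  refine tendsto_of_tendsto_of_tendsto_of_le_of_le' tendsto_const_nhds h
    (Eventually.of_forall fun _ => zero_le) ?_
  filter_upwards [hle] with n hn
  refine measure_mono_ae ?_
  filter_upwards [hn] with ω hω hωε
  have h1 : ε ≤ ‖f n ω - 0‖ := hωε
  rw [sub_zero, Real.norm_eq_abs] at h1
  exact h1.trans hω

theorem tendstoInMeasure_zero_of_integral_sq_le {P : Measure Ω} [IsProbabilityMeasure P]
    {f : ℕ → Ω → ℝ} {b : ℕ → ℝ} (hint : ∀ᶠ n in atTop, Integrable (fun ω => f n ω ^ 2) P)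
    (hb : ∀ᶠ n in atTop, ∫ ω, f n ω ^ 2 ∂P ≤ b n) (hb0 : Tendsto b atTop (𝓝 0)) :
    TendstoInMeasure P f atTop fun _ => 0 := by
  have h := tendstoInMeasure_zero_of_integral_le (f := fun n ω => f n ω ^ 2)
    (Eventually.of_forall fun n => ae_of_all P fun ω => (abs_of_nonneg (sq_nonneg (f n ω))).le)
    hint hb hb0
  rw [tendstoInMeasure_iff_norm] at h ⊢
  intro ε hε
  refine (h (ε ^ 2) (by positivity)).congr fun n => ?_
  congr 1 with ω
  simp only [mem_ofPred_eq, sub_zero, Real.norm_eq_abs, abs_pow]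
  exact pow_le_pow_iff_left₀ hε.le (abs_nonneg _) two_ne_zero

end GPPTest

/-! ### Likelihood ratios of point processes -/

namespace GPPTest

variable {Ω : Type*} [MeasurableSpace Ω]

/-- Rectangles determine a product measure. On a rectangle, indicator times density is a product of
functions of independent coordinates, so its integral factorizes. -/
theorem pi_withDensity {ι : Type*} [Fintype ι] {α : Type*} [MeasurableSpace α] {μ : Measure α}
    [IsProbabilityMeasure μ] {g : α → ENNReal} (hg : Measurable g)
    [IsProbabilityMeasure (μ.withDensity g)] :
    Measure.pi (fun _ : ι => μ.withDensity g)
      = (Measure.pi fun _ : ι => μ).withDensity fun v => ∏ i, g (v i) := by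
  refine Measure.pi_eq fun s hs => ?_
  rw [withDensity_apply _ (MeasurableSet.univ_pi hs), ← lintegral_indicator (MeasurableSet.univ_pi hs)]
  have h1 : ∀ v : ι → α, (univ.pi s).indicator (fun v => ∏ i, g (v i)) v
      = ∏ i, (s i).indicator g (v i) := fun v => by
    by_cases hv : v ∈ univ.pi s
    · rw [indicator_of_mem hv]
      exact Finset.prod_congr rfl fun i _ => (indicator_of_mem (hv i (mem_univ i)) g).symm
    · rw [indicator_of_notMem hv]
      simp only [Set.mem_pi, mem_univ, true_imp_iff, not_forall] at hv
      obtain ⟨i, hi⟩ := hv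
      exact (Finset.prod_eq_zero (Finset.mem_univ i) (indicator_of_notMem hi g)).symm
  simp_rw [h1]
  have hind : iIndepFun (fun i (v : ι → α) => (s i).indicator g (v i)) (Measure.pi fun _ => μ) :=
    iIndepFun_pi (X := fun i => (s i).indicator g) fun i => (hg.indicator (hs i)).aemeasurable
  rw [lintegral_prod_eq_prod_lintegral_of_indepFun Finset.univ _ hind
    fun i => (hg.indicator (hs i)).comp (measurable_pi_apply i)]
  refine Finset.prod_congr rfl fun i _ => ?_
  rw [withDensity_apply _ (hs i), ← lintegral_indicator (hs i)]
  exact (measurePreserving_eval (fun _ : ι => μ) i).lintegral_comp (hg.indicator (hs i))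

theorem map_withDensity_comp {α E : Type*} [MeasurableSpace α] [MeasurableSpace E] {μ : Measure α}
    {T : α → E} (hT : Measurable T) {G : E → ENNReal} (hG : Measurable G) :
    (μ.withDensity fun v => G (T v)).map T = (μ.map T).withDensity G := by
  ext s hs
  rw [Measure.map_apply hT hs, withDensity_apply _ (hT hs), withDensity_apply _ hs,
    setLIntegral_map hs hG hT]

/-- The point measure of the values in `[0,1]`. -/
noncomputable def pointMeasure (n : ℕ) (v : ℕ → ℝ) : Measure ℝ :=
  ∑ i ∈ Finset.range n, (Measure.dirac (v i)).restrict (Icc 0 1)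

theorem measurable_pointMeasure (n : ℕ) : Measurable (pointMeasure n) := by
  refine Measure.measurable_of_measurable_coe _ fun s hs => ?_
  simp only [pointMeasure, Measure.finsetSum_apply, Measure.restrict_apply hs]
  refine Finset.measurable_sum _ fun i _ => ?_
  have h := (Measure.measurable_coe (hs.inter (measurableSet_Icc (a := (0:ℝ)) (b := 1)))).comp
    (Measure.measurable_dirac.comp (measurable_pi_apply (X := fun _ : ℕ => ℝ) i))
  exact h

theorem lintegral_pointMeasure (n : ℕ) (v : ℕ → ℝ) {f : ℝ → ENNReal} (hf : Measurable f) :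
    ∫⁻ y, f y ∂pointMeasure n v = ∑ i ∈ Finset.range n, (Icc 0 1).indicator f (v i) := by
  rw [pointMeasure, lintegral_finsetSum_measure]
  refine Finset.sum_congr rfl fun i _ => ?_
  rw [← lintegral_indicator measurableSet_Icc, lintegral_dirac' _ (hf.indicator measurableSet_Icc)]

/-- Per-observation log density: `log (1 + x)` on `[0,1]` and the constant `l` elsewhere. -/
noncomputable def logDens (l : ℝ) (x : ℝ → ℝ) : ℝ → ℝ :=
  fun v => l + (Icc 0 1).indicator (fun v => Real.log (1 + x v) - l) v

theorem measurable_logDens {l : ℝ} {x : ℝ → ℝ} (hx : Measurable x) : Measurable (logDens l x) := by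
  have : Measurable fun v => Real.log (1 + x v) - l := by fun_prop
  exact (this.indicator measurableSet_Icc).const_add l

/-- The likelihood ratio as a function of the point measure. -/
noncomputable def pointLR (n : ℕ) (l : ℝ) (x : ℝ → ℝ) (N : Measure ℝ) : ENNReal :=
  -- Positive and negative parts are integrated separately so that each integral is measurable in
  -- `N`. The term `n * l` charges `l` to all observations, and the integrand `log (1 + x) - l`
  -- corrects this at the exceedances.
  ENNReal.ofReal (Real.exp (n * l +
    ((∫⁻ y, ENNReal.ofReal (Real.log (1 + x y) - l) ∂N).toReal
      - (∫⁻ y, ENNReal.ofReal (-(Real.log (1 + x y) - l)) ∂N).toReal)))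

theorem measurable_pointLR {n : ℕ} {l : ℝ} {x : ℝ → ℝ} (hx : Measurable x) :
    Measurable (pointLR n l x) := by
  have h1 := Measure.measurable_lintegral
    (f := fun y => ENNReal.ofReal (Real.log (1 + x y) - l)) (by fun_prop)
  have h2 := Measure.measurable_lintegral
    (f := fun y => ENNReal.ofReal (-(Real.log (1 + x y) - l))) (by fun_prop)
  unfold pointLR
  fun_prop

theorem pointLR_pointMeasure (n : ℕ) (l : ℝ) {x : ℝ → ℝ} (hx : Measurable x) (v : ℕ → ℝ) :
    pointLR n l x (pointMeasure n v)
      = ENNReal.ofReal (Real.exp (∑ i ∈ Finset.range n, logDens l x (v i))) := by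
  have hfin : ∀ (f : ℝ → ℝ) (i : ℕ),
      (Icc (0:ℝ) 1).indicator (fun y => ENNReal.ofReal (f y)) (v i) ≠ ⊤ := fun f i => by
    by_cases h : v i ∈ Icc (0:ℝ) 1 <;> simp [h]
  rw [pointLR, lintegral_pointMeasure _ _ (by fun_prop), lintegral_pointMeasure _ _ (by fun_prop),
    ENNReal.toReal_sum fun i _ => hfin _ i, ENNReal.toReal_sum fun i _ => hfin _ i,
    ← Finset.sum_sub_distrib]
  have : (n : ℝ) * l = ∑ i ∈ Finset.range n, l := by simp
  rw [this, ← Finset.sum_add_distrib]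
  congr 2
  refine Finset.sum_congr rfl fun i _ => ?_
  unfold logDens
  by_cases h : v i ∈ Icc (0:ℝ) 1
  · simp only [indicator_of_mem h]
    rw [ENNReal.toReal_ofReal', ENNReal.toReal_ofReal',
      max_zero_sub_max_neg_zero_eq_self (Real.log (1 + x (v i)) - l)]
  · simp [h]

/-- Truncation sending everything outside `[0,1]` to the point `2`. -/
noncomputable def cut (v : ℝ) : ℝ := if v ∈ Icc (0:ℝ) 1 then v else 2

theorem measurable_cut : Measurable cut :=
  Measurable.ite measurableSet_Icc measurable_id measurable_const

/-- The replacement value `2` lies outside `[0,1]`, so values that left no trace in the point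
measure still leave none. -/
theorem pointMeasure_cut (n : ℕ) (v : ℕ → ℝ) :
    pointMeasure n (fun i => cut (v i)) = pointMeasure n v := by
  refine Finset.sum_congr rfl fun i _ => ?_
  simp only [cut]
  split_ifs with h
  · rfl
  · ext s hs
    rw [Measure.restrict_apply hs, Measure.restrict_apply hs,
      Measure.dirac_apply' _ (hs.inter measurableSet_Icc),
      Measure.dirac_apply' _ (hs.inter measurableSet_Icc), indicator_of_notMem,
      indicator_of_notMem]
    · exact fun hm => h hm.2
    · rintro ⟨-, hm⟩
      norm_num at hm

/-- Off `[0,1]` the measure `ν₁` need not be dominated by `ν₀`. After `cut` only the total masses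
there matter, and their ratio is the constant `exp l`. -/
theorem map_cut_eq_withDensity {ν₀ ν₁ : Measure ℝ} {x : ℝ → ℝ} (hx : Measurable x)
    (hx0 : ∀ v ∈ Icc (0:ℝ) 1, -(1 / 2) ≤ x v)
    (hin : ν₁.restrict (Icc 0 1)
      = (ν₀.restrict (Icc 0 1)).withDensity fun v => ENNReal.ofReal (1 + x v))
    {l : ℝ} (hout : ν₁ (Icc 0 1)ᶜ = ENNReal.ofReal (Real.exp l) * ν₀ (Icc 0 1)ᶜ) :
    ν₁.map cut = (ν₀.map cut).withDensity fun v => ENNReal.ofReal (Real.exp (logDens l x v)) := by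
  have hm : Measurable fun v => ENNReal.ofReal (Real.exp (logDens l x v)) := by
    have := measurable_logDens (l := l) hx
    fun_prop
  ext s hs
  have hs' := measurable_cut hs
  have h2 : (2:ℝ) ∉ Icc (0:ℝ) 1 := by norm_num
  rw [Measure.map_apply measurable_cut hs, withDensity_apply _ hs, setLIntegral_map hs hm
    measurable_cut, ← lintegral_inter_add_sdiff _ _ measurableSet_Icc,
    ← measure_inter_add_sdiff _ (measurableSet_Icc (a := (0:ℝ)) (b := 1))]
  congr 1
  · have e1 : ν₁ (cut ⁻¹' s ∩ Icc 0 1) = (ν₁.restrict (Icc 0 1)) (cut ⁻¹' s) := by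
      rw [Measure.restrict_apply hs']
    rw [e1, hin, withDensity_apply _ hs', Measure.restrict_restrict hs']
    refine setLIntegral_congr_fun (hs'.inter measurableSet_Icc) fun v hv => ?_
    have hx1 := hx0 v hv.2
    simp only [cut, logDens, hv.2, if_true, indicator_of_mem]
    rw [add_sub_cancel, Real.exp_log (by linarith)]
  · have e1 : ∫⁻ v in cut ⁻¹' s \ Icc 0 1, ENNReal.ofReal (Real.exp (logDens l x (cut v))) ∂ν₀
        = ∫⁻ v in cut ⁻¹' s \ Icc 0 1, ENNReal.ofReal (Real.exp l) ∂ν₀ := by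
      refine setLIntegral_congr_fun (hs'.diff measurableSet_Icc) fun v hv => ?_
      simp only [cut, logDens, hv.2, if_false, indicator_of_notMem h2, add_zero]
    rw [e1, setLIntegral_const]
    by_cases h : (2:ℝ) ∈ s
    · have : cut ⁻¹' s \ Icc 0 1 = (Icc 0 1)ᶜ := by
        ext v
        simp only [Set.mem_sdiff, mem_preimage, mem_compl_iff, and_iff_right_iff_imp]
        intro hv
        simpa only [cut, hv, if_false] using h
      rw [this, hout]
    · have : cut ⁻¹' s \ Icc 0 1 = ∅ := by
        ext v
        simp only [Set.mem_sdiff, mem_preimage, mem_empty_iff_false, iff_false, not_and_not_right]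
        intro hv
        by_contra hv'
        simp only [cut, hv', if_false] at hv
        exact h hv
      rw [this]; simp

/-- Realizes the point process on a finite product space, with the cut values as coordinates; there
the densities multiply. -/
theorem map_pointMeasure_eq_map_pi {P : Measure Ω} [IsProbabilityMeasure P] {V : ℕ → Ω → ℝ}
    (hV : ∀ i, Measurable (V i)) (hind : iIndepFun V P) {ν : Measure ℝ}
    (hν : ∀ i, P.map (V i) = ν) (n : ℕ) :
    P.map (fun ω => pointMeasure n fun i => V i ω)
      = (Measure.pi fun _ : Fin n => ν.map cut).map
        (fun v => pointMeasure n fun i => if h : i < n then v ⟨i, h⟩ else 0) := by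
  have hindn : iIndepFun (fun (i : Fin n) ω => cut (V i ω)) P :=
    (hind.comp (fun _ => cut) fun _ => measurable_cut).precomp Fin.val_injective
  have hm : ∀ i : Fin n, Measurable (fun ω => cut (V i ω)) := fun i => measurable_cut.comp (hV i)
  have h := hindn.map_fun_eq_pi_map fun i => (hm i).aemeasurable
  have h' : ∀ i : Fin n, P.map (fun ω => cut (V i ω)) = ν.map cut := fun i => by
    rw [← hν i, Measure.map_map measurable_cut (hV i)]; rfl
  simp only [h'] at h
  -- The default `0` is never read: `pointMeasure n` only uses indices below `n`.
  have hT : Measurable fun v : Fin n → ℝ =>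
      pointMeasure n fun i => if h : i < n then v ⟨i, h⟩ else 0 := by
    refine (measurable_pointMeasure n).comp (measurable_pi_lambda _ fun i => ?_)
    split_ifs <;> fun_prop
  rw [← h, Measure.map_map hT (measurable_pi_lambda _ hm)]
  congr 1
  funext ω
  simp only [Function.comp_apply]
  rw [← pointMeasure_cut n fun i => V i ω]
  refine Finset.sum_congr rfl fun i hi => ?_
  simp [Finset.mem_range.1 hi]

/-- Likelihood ratio of the point processes of the values in `[0,1]` of two i.i.d. samples. -/
theorem map_pointMeasure_eq_withDensity {P₀ P₁ : Measure Ω} [IsProbabilityMeasure P₀]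
    [IsProbabilityMeasure P₁] {V : ℕ → Ω → ℝ} (hV : ∀ i, Measurable (V i))
    (hind₀ : iIndepFun V P₀) (hind₁ : iIndepFun V P₁) {ν₀ ν₁ : Measure ℝ}
    (hν₀ : ∀ i, P₀.map (V i) = ν₀) (hν₁ : ∀ i, P₁.map (V i) = ν₁) {x : ℝ → ℝ} (hx : Measurable x)
    (hx0 : ∀ v ∈ Icc (0:ℝ) 1, -(1 / 2) ≤ x v)
    (hin : ν₁.restrict (Icc 0 1)
      = (ν₀.restrict (Icc 0 1)).withDensity fun v => ENNReal.ofReal (1 + x v))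
    {l : ℝ} (hout : ν₁ (Icc 0 1)ᶜ = ENNReal.ofReal (Real.exp l) * ν₀ (Icc 0 1)ᶜ) (n : ℕ) :
    P₁.map (fun ω => pointMeasure n fun i => V i ω)
      = (P₀.map (fun ω => pointMeasure n fun i => V i ω)).withDensity (pointLR n l x) := by
  have : IsProbabilityMeasure ν₀ := by
    rw [← hν₀ 0]; exact Measure.isProbabilityMeasure_map (hV 0).aemeasurable
  have : IsProbabilityMeasure ν₁ := by
    rw [← hν₁ 0]; exact Measure.isProbabilityMeasure_map (hV 0).aemeasurable
  have : IsProbabilityMeasure (ν₀.map cut) :=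
    Measure.isProbabilityMeasure_map measurable_cut.aemeasurable
  have hp : IsProbabilityMeasure (ν₁.map cut) :=
    Measure.isProbabilityMeasure_map measurable_cut.aemeasurable
  have hT : Measurable fun v : Fin n → ℝ =>
      pointMeasure n fun i => if h : i < n then v ⟨i, h⟩ else 0 := by
    refine (measurable_pointMeasure n).comp (measurable_pi_lambda _ fun i => ?_)
    split_ifs <;> fun_prop
  have hg : Measurable fun v => ENNReal.ofReal (Real.exp (logDens l x v)) := by
    have := measurable_logDens (l := l) hx
    fun_prop
  -- The product density depends on the sample only through its point measure, so it passes to the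
  -- image under the point measure map as the density `pointLR`.
  rw [map_pointMeasure_eq_map_pi hV hind₀ hν₀, map_pointMeasure_eq_map_pi hV hind₁ hν₁,
    ← map_withDensity_comp hT (measurable_pointLR hx)]
  rw [map_cut_eq_withDensity hx hx0 hin hout] at hp ⊢
  rw [pi_withDensity hg]
  congr 2
  funext v
  rw [pointLR_pointMeasure _ _ hx, Real.exp_sum, ENNReal.ofReal_prod_of_nonneg
    fun _ _ => (Real.exp_pos _).le, Finset.prod_range]
  simp

theorem llr_map_pointMeasure {P₀ P₁ : Measure Ω} [IsProbabilityMeasure P₀]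
    {V : ℕ → Ω → ℝ} (hV : ∀ i, Measurable (V i)) {x : ℝ → ℝ} (hx : Measurable x) {l : ℝ} {n : ℕ}
    (h : P₁.map (fun ω => pointMeasure n fun i => V i ω)
      = (P₀.map (fun ω => pointMeasure n fun i => V i ω)).withDensity (pointLR n l x)) :
    ∀ᵐ ω ∂P₀, llr (P₁.map (fun ω => pointMeasure n fun i => V i ω))
        (P₀.map (fun ω => pointMeasure n fun i => V i ω)) (pointMeasure n fun i => V i ω)
      = ∑ i ∈ Finset.range n, logDens l x (V i ω) := by
  have hm : Measurable fun ω => pointMeasure n fun i => V i ω :=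
    (measurable_pointMeasure n).comp (measurable_pi_lambda _ hV)
  have : IsProbabilityMeasure (P₀.map (fun ω => pointMeasure n fun i => V i ω)) :=
    Measure.isProbabilityMeasure_map hm.aemeasurable
  have h1 := Measure.rnDeriv_withDensity (P₀.map (fun ω => pointMeasure n fun i => V i ω))
    (measurable_pointLR (n := n) (l := l) hx)
  rw [← h] at h1
  filter_upwards [ae_of_ae_map hm.aemeasurable h1] with ω hω
  rw [llr, hω, pointLR_pointMeasure _ _ hx, ENNReal.toReal_ofReal (Real.exp_pos _).le,
    Real.log_exp]

end GPPTest

/-! ### The law of a rescaled observation on `[0,1]` -/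

namespace GPPTest

variable {Ω : Type*} [MeasurableSpace Ω]

/-- The minimum of a path. -/
noncomputable def pathInf (z : C(unitInterval, ℝ)) : ℝ := ⨅ t, z t

theorem continuous_pathInf : Continuous pathInf := by
  have h := isCompact_univ.continuous_sInf (K := (univ : Set unitInterval))
    (f := fun (z : C(unitInterval, ℝ)) t => z t) (by fun_prop)
  simp only [image_univ] at h
  exact h

theorem exists_eq_pathInf (z : C(unitInterval, ℝ)) : ∃ t, z t = pathInf z ∧ ∀ s, z t ≤ z s := by
  obtain ⟨t, -, ht⟩ := isCompact_univ.exists_isMinOn (univ_nonempty (α := unitInterval))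
    z.continuous.continuousOn
  have h : ∀ s, z t ≤ z s := fun s => ht (mem_univ s)
  refine ⟨t, le_antisymm (le_ciInf h) (ciInf_le ⟨z t, ?_⟩ t), h⟩
  rintro _ ⟨s, rfl⟩
  exact h s

/-- The minimum is attained and the power is monotone. This makes `constB` a moment of `pathInf`. -/
theorem iInf_rpow_eq {z : C(unitInterval, ℝ)} (hz : ∀ t, 0 ≤ z t) {a : ℝ} (ha : 0 ≤ a) :
    ⨅ t, z t ^ a = pathInf z ^ a := by
  obtain ⟨t, ht, hmin⟩ := exists_eq_pathInf z
  have h : ∀ s, z t ^ a ≤ z s ^ a := fun s => Real.rpow_le_rpow (hz t) (hmin s) ha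
  rw [← ht]
  refine le_antisymm (ciInf_le ⟨z t ^ a, ?_⟩ t) (le_ciInf h)
  rintro _ ⟨s, rfl⟩
  exact h s

/-- A measurable nonnegative version of `supX`. -/
noncomputable def obs (M c : ℝ) (y : ℝ × C(unitInterval, ℝ)) : ℝ :=
  if 0 < pathInf y.2 then min (|y.1| / pathInf y.2) |M| / |c| else |M| / |c|

theorem measurable_pathInf : Measurable pathInf := continuous_pathInf.measurable

theorem measurable_obs (M c : ℝ) : Measurable (obs M c) := by
  have h : Measurable fun y : ℝ × C(unitInterval, ℝ) => pathInf y.2 :=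
    measurable_pathInf.comp measurable_snd
  refine Measurable.ite (measurableSet_lt measurable_const h) ?_ measurable_const
  have h2 : Measurable fun y : ℝ × C(unitInterval, ℝ) => |y.1| :=
    continuous_abs.measurable.comp measurable_fst
  exact ((h2.div h).min measurable_const).div_const _

theorem obs_nonneg (M c : ℝ) (y : ℝ × C(unitInterval, ℝ)) : 0 ≤ obs M c y := by
  unfold obs
  split_ifs <;> positivity

/-- Division by `c < 0` reverses the order, so the supremum sits where `X_t` is smallest, that is,
at a minimizer of `z`. If the minimum is zero, then `X_t = M` there, the smallest possible value. -/
theorem supX_eq_obs {M c w : ℝ} {z : C(unitInterval, ℝ)} (hM : M < 0) (hc : c < 0) (hw : 0 ≤ w)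
    (hz : ∀ t, 0 ≤ z t) : supX M c w z = obs M c (w, z) := by
  obtain ⟨t, ht, hmin⟩ := exists_eq_pathInf z
  have hup : ∀ s, pathX M w z s / c ≤ pathX M w z t / c := fun s => by
    refine div_le_div_of_nonpos_of_le hc.le ?_
    unfold pathX
    by_cases h0 : z t = 0
    · rw [if_pos h0]
      split_ifs
      exacts [le_rfl, le_max_right _ _]
    · have h1 : 0 < z t := lt_of_le_of_ne (hz t) (Ne.symm h0)
      have h2 : 0 < z s := h1.trans_le (hmin s)
      rw [if_neg h0, if_neg h2.ne']
      refine max_le_max ?_ le_rfl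
      rw [neg_div, neg_div]
      exact neg_le_neg (div_le_div_of_nonneg_left hw h1 (hmin s))
  have hsup : supX M c w z = pathX M w z t / c :=
    le_antisymm (ciSup_le hup) (le_ciSup (f := fun t => pathX M w z t / c)
      ⟨_, by rintro _ ⟨s, rfl⟩; exact hup s⟩ t)
  rw [hsup, obs, ← ht, abs_of_neg hM, abs_of_neg hc, abs_of_nonneg hw]
  unfold pathX
  by_cases h0 : z t = 0
  · rw [if_pos h0, if_neg (by simp [h0]), neg_div_neg_eq]
  · rw [if_neg h0, if_pos (lt_of_le_of_ne (hz t) (Ne.symm h0)), ← neg_neg (w / z t), min_neg_neg,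
      neg_div_neg_eq, neg_div]

theorem setLIntegral_comp_mul_left {a : ℝ} (ha : 0 < a) {h : ℝ → ENNReal} (hh : Measurable h)
    {s : Set ℝ} (hs : MeasurableSet s) :
    ∫⁻ w in {w | w / a ∈ s}, h w = ∫⁻ v in s, ENNReal.ofReal a * h (a * v) := by
  have hs' : MeasurableSet {w | w / a ∈ s} := hs.preimage (measurable_id.div_const a)
  have hm : Measurable fun v : ℝ => a * v := by fun_prop
  have he : (fun v : ℝ => a * v) ⁻¹' {w | w / a ∈ s} = s := by
    ext v
    simp [mul_div_cancel_left₀ _ ha.ne']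
  conv_lhs => rw [← Real.smul_map_volume_mul_left ha.ne']
  rw [Measure.restrict_smul, lintegral_smul_measure, setLIntegral_map hs' hh hm, he,
    abs_of_pos ha, smul_eq_mul]
  exact (lintegral_const_mul _ (hh.comp hm)).symm

/-- The relative density, minus one, of the observation on `[0,1]`. -/
noncomputable def relDens (Q : Measure C(unitInterval, ℝ)) (h : ℝ → ℝ) (c v : ℝ) : ℝ :=
  (constA Q)⁻¹ * ∫ z, pathInf z * (h (pathInf z * |c| * v) - 1) ∂Q

theorem measurable_relDens {Q : Measure C(unitInterval, ℝ)} [IsProbabilityMeasure Q] {h : ℝ → ℝ}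
    (hh : Measurable h) (c : ℝ) : Measurable (relDens Q h c) := by
  have h1 : Measurable fun y : ℝ × C(unitInterval, ℝ) => pathInf y.2 :=
    measurable_pathInf.comp measurable_snd
  have : StronglyMeasurable (Function.uncurry fun (v : ℝ) (z : C(unitInterval, ℝ)) =>
      pathInf z * (h (pathInf z * |c| * v) - 1)) := by
    refine Measurable.stronglyMeasurable (h1.mul (Measurable.sub_const (hh.comp ?_) 1))
    exact (h1.mul_const _).mul measurable_fst
  exact (this.integral_prod_right).measurable.const_mul _

section Law

variable {Q : Measure C(unitInterval, ℝ)} {μ : Measure ℝ} {h : ℝ → ℝ} {δ M c m u₀ ϑ e : ℝ}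

/-- Truncation at `M` produces the value `|M| / |c| > 1`, so it never affects what happens inside
`[0,1]`. -/
theorem obs_mem_iff (hμ0 : μ (Iio 0) = 0) (hM : |c| < |M|) (hc : 0 < |c|)
    {z : C(unitInterval, ℝ)} (hz : 0 < pathInf z) {s : Set ℝ} (hs : s ⊆ Icc 0 1) :
    ∀ᵐ w ∂μ, obs M c (w, z) ∈ s ↔ w / (pathInf z * |c|) ∈ s := by
  have h0 : ∀ᵐ w ∂μ, 0 ≤ w := by
    rw [ae_iff]
    simp only [not_le]
    exact hμ0
  filter_upwards [h0] with w hw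
  simp only [obs, if_pos hz, abs_of_nonneg hw]
  rcases le_total (w / pathInf z) |M| with h1 | h1
  · rw [min_eq_left h1, div_div]
  · rw [min_eq_right h1]
    have h2 : 1 < |M| / |c| := (one_lt_div hc).2 hM
    have h3 : |M| / |c| ≤ w / (pathInf z * |c|) := by
      rw [← div_div]; gcongr
    exact iff_of_false (fun hh => absurd (hs hh).2 (by linarith))
      fun hh => absurd (hs hh).2 (by linarith)

/-- For a fixed path this is the substitution `w = pathInf z * |c| * v`; a path with minimum zero
gives no exceedance and both sides vanish. -/
theorem measure_obs_mem (hμ0 : μ (Iio 0) = 0) (hh : Measurable h)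
    (hμ : μ.restrict (Icc 0 u₀)
      = ((volume : Measure ℝ).restrict (Icc 0 u₀)).withDensity fun u => ENNReal.ofReal (h u))
    (hM : |c| < |M|) (hc : 0 < |c|) {z : C(unitInterval, ℝ)} (hz0 : 0 ≤ pathInf z)
    (hzm : pathInf z * |c| ≤ u₀) {s : Set ℝ} (hs : MeasurableSet s) (hs1 : s ⊆ Icc 0 1) :
    μ {w | obs M c (w, z) ∈ s}
      = ∫⁻ v in s, ENNReal.ofReal (pathInf z * |c|) *
          ENNReal.ofReal (h (pathInf z * |c| * v)) := by
  rcases hz0.eq_or_lt with h0 | hz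
  · have h1 : {w | obs M c (w, z) ∈ s} = ∅ := by
      ext w
      simp only [mem_ofPred_eq, mem_empty_iff_false, iff_false, obs, ← h0, lt_irrefl, if_false]
      intro hh
      have h2 : 1 < |M| / |c| := (one_lt_div hc).2 hM
      exact absurd (hs1 hh).2 (by linarith)
    rw [h1]
    simp [← h0]
  · have ha : 0 < pathInf z * |c| := mul_pos hz hc
    have hs' : MeasurableSet {w | w / (pathInf z * |c|) ∈ s} :=
      hs.preimage (measurable_id.div_const _)
    have hsub : {w | w / (pathInf z * |c|) ∈ s} ⊆ Icc 0 u₀ := fun w hw => by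
      have h1 := hs1 hw
      rw [mem_Icc, le_div_iff₀ ha, div_le_iff₀ ha] at h1
      exact ⟨by linarith [h1.1], by linarith [h1.2]⟩
    rw [← setLIntegral_comp_mul_left ha hh.ennreal_ofReal hs,
      measure_congr (t := {w | w / (pathInf z * |c|) ∈ s})
        (by filter_upwards [obs_mem_iff hμ0 hM hc hz hs1] with w hw using propext hw),
      ← Measure.restrict_eq_self μ hsub, hμ, withDensity_apply _ hs', Measure.restrict_restrict hs',
      inter_eq_left.2 hsub]

theorem ae_pathInf_mem (hz : ∀ᵐ z ∂Q, ∀ t, 0 ≤ z t ∧ z t ≤ m) :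
    ∀ᵐ z ∂Q, 0 ≤ pathInf z ∧ pathInf z ≤ m := by
  filter_upwards [hz] with z hz
  obtain ⟨t, ht, -⟩ := exists_eq_pathInf z
  rw [← ht]
  exact hz t

theorem constB_eq (hδ : 0 < δ) (hz : ∀ᵐ z ∂Q, ∀ t, 0 ≤ z t ∧ z t ≤ m) :
    constB Q δ = ∫ z, pathInf z ^ (1 + δ) ∂Q := by
  refine integral_congr_ae ?_
  filter_upwards [hz] with z hz
  exact iInf_rpow_eq (fun t => (hz t).1) (by linarith)

theorem constB_nonneg (hδ : 0 < δ) (hz : ∀ᵐ z ∂Q, ∀ t, 0 ≤ z t ∧ z t ≤ m) :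
    0 ≤ constB Q δ := by
  rw [constB_eq hδ hz]
  refine integral_nonneg_of_ae ?_
  filter_upwards [ae_pathInf_mem hz] with z hp
  exact Real.rpow_nonneg hp.1 _

variable [IsProbabilityMeasure Q]

theorem mul_mem_Icc_of_le {p v : ℝ} (hp : 0 ≤ p ∧ p ≤ m) (hcm : |c| * m ≤ u₀)
    (hv : v ∈ Icc (0:ℝ) 1) : p * |c| * v ∈ Icc 0 u₀ := by
  have h1 : 0 ≤ p * |c| := mul_nonneg hp.1 (abs_nonneg c)
  refine ⟨mul_nonneg h1 hv.1, (mul_le_of_le_one_right h1 hv.2).trans ?_⟩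
  rw [mul_comm]
  exact (mul_le_mul_of_nonneg_left hp.2 (abs_nonneg c)).trans hcm

theorem integrable_pathInf (hz : ∀ᵐ z ∂Q, ∀ t, 0 ≤ z t ∧ z t ≤ m) : Integrable pathInf Q := by
  refine Integrable.of_bound measurable_pathInf.aestronglyMeasurable m ?_
  filter_upwards [ae_pathInf_mem hz] with z hp
  rw [Real.norm_eq_abs, abs_of_nonneg hp.1]
  exact hp.2

theorem integrable_pathInf_rpow (hδ : 0 < δ) (hz : ∀ᵐ z ∂Q, ∀ t, 0 ≤ z t ∧ z t ≤ m) :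
    Integrable (fun z => pathInf z ^ (1 + δ)) Q := by
  refine Integrable.of_bound (measurable_pathInf.pow_const _).aestronglyMeasurable (m ^ (1 + δ)) ?_
  filter_upwards [ae_pathInf_mem hz] with z hp
  rw [Real.norm_eq_abs, abs_of_nonneg (Real.rpow_nonneg hp.1 _)]
  exact Real.rpow_le_rpow hp.1 hp.2 (by linarith)

theorem integrable_pathInf_mul (hδ : 0 < δ) (hz : ∀ᵐ z ∂Q, ∀ t, 0 ≤ z t ∧ z t ≤ m)
    (hh : Measurable h) (hr : ∀ u ∈ Icc 0 u₀, |h u - 1 - ϑ * u ^ δ| ≤ e * |ϑ| * u ^ δ)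
    (he : 0 ≤ e) (hcm : |c| * m ≤ u₀) {v : ℝ} (hv : v ∈ Icc (0:ℝ) 1) :
    Integrable (fun z => pathInf z * (h (pathInf z * |c| * v) - 1)) Q := by
  have hmeas : Measurable fun z => pathInf z * (h (pathInf z * |c| * v) - 1) :=
    measurable_pathInf.mul ((hh.comp ((measurable_pathInf.mul_const _).mul_const _)).sub_const 1)
  refine Integrable.of_bound hmeas.aestronglyMeasurable (m * ((e + 1) * |ϑ| * u₀ ^ δ)) ?_
  filter_upwards [ae_pathInf_mem hz] with z hp
  have hu := mul_mem_Icc_of_le hp hcm hv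
  have h1 := hr _ hu
  set u := pathInf z * |c| * v
  rw [norm_mul, Real.norm_eq_abs, Real.norm_eq_abs, abs_of_nonneg hp.1]
  have h2 : u ^ δ ≤ u₀ ^ δ := Real.rpow_le_rpow hu.1 hu.2 hδ.le
  have h3 : 0 ≤ u ^ δ := Real.rpow_nonneg hu.1 _
  have h4 : |h u - 1| ≤ (e + 1) * |ϑ| * u ^ δ := by
    calc |h u - 1| = |(h u - 1 - ϑ * u ^ δ) + ϑ * u ^ δ| := by ring_nf
      _ ≤ |h u - 1 - ϑ * u ^ δ| + |ϑ * u ^ δ| := abs_add_le _ _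
      _ ≤ e * |ϑ| * u ^ δ + |ϑ| * u ^ δ := by
        rw [abs_mul, abs_of_nonneg h3]; gcongr
      _ = _ := by ring
  calc pathInf z * |h u - 1| ≤ m * ((e + 1) * |ϑ| * u ^ δ) :=
        mul_le_mul hp.2 h4 (abs_nonneg _) (hp.1.trans hp.2)
    _ ≤ _ := by
        have := hp.1.trans hp.2
        gcongr

/-- With `I = pathInf z`, the identity `I (I |c| v)^δ = |c|^δ v^δ I^(1+δ)` shows how `B` arises on
averaging over `Q`. The same identity integrates the relative error `e`. For `ϑ = 0` the bound is
zero and `relDens` vanishes exactly on `[0,1]`. -/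
theorem abs_relDens_sub_le (hδ : 0 < δ) (hA : 0 < constA Q)
    (hz : ∀ᵐ z ∂Q, ∀ t, 0 ≤ z t ∧ z t ≤ m) (hh : Measurable h)
    (hr : ∀ u ∈ Icc 0 u₀, |h u - 1 - ϑ * u ^ δ| ≤ e * |ϑ| * u ^ δ) (he : 0 ≤ e)
    (hcm : |c| * m ≤ u₀) {v : ℝ} (hv : v ∈ Icc (0:ℝ) 1) :
    |relDens Q h c v - ϑ * |c| ^ δ * (constB Q δ / constA Q) * v ^ δ|
      ≤ e * |ϑ * |c| ^ δ| * (constB Q δ / constA Q) := by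
  have i1 := integrable_pathInf_mul hδ hz hh hr he hcm hv
  have i2 := integrable_pathInf_rpow (δ := δ) hδ hz
  have hpow : ∀ z : C(unitInterval, ℝ), 0 ≤ pathInf z →
      pathInf z * (pathInf z * |c| * v) ^ δ = |c| ^ δ * v ^ δ * pathInf z ^ (1 + δ) := fun z hp => by
    rw [Real.mul_rpow (mul_nonneg hp (abs_nonneg c)) hv.1, Real.mul_rpow hp (abs_nonneg c),
      Real.rpow_add_of_nonneg hp zero_le_one hδ.le, Real.rpow_one]
    ring
  have e1 : relDens Q h c v - ϑ * |c| ^ δ * (constB Q δ / constA Q) * v ^ δ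
      = (constA Q)⁻¹ * ∫ z, (pathInf z * (h (pathInf z * |c| * v) - 1)
        - ϑ * |c| ^ δ * v ^ δ * pathInf z ^ (1 + δ)) ∂Q := by
    rw [integral_sub i1 (i2.const_mul _), integral_const_mul, ← constB_eq hδ hz, relDens]
    ring
  have h1 : ‖∫ z, (pathInf z * (h (pathInf z * |c| * v) - 1)
        - ϑ * |c| ^ δ * v ^ δ * pathInf z ^ (1 + δ)) ∂Q‖
      ≤ ∫ z, e * |ϑ| * |c| ^ δ * pathInf z ^ (1 + δ) ∂Q := by
    refine norm_integral_le_of_norm_le (i2.const_mul _) ?_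
    filter_upwards [ae_pathInf_mem hz] with z hp
    have h2 := hr _ (mul_mem_Icc_of_le hp hcm hv)
    have h3 : pathInf z * (h (pathInf z * |c| * v) - 1) - ϑ * |c| ^ δ * v ^ δ * pathInf z ^ (1 + δ)
        = pathInf z * (h (pathInf z * |c| * v) - 1 - ϑ * (pathInf z * |c| * v) ^ δ) := by
      linear_combination ϑ * hpow z hp.1
    have hv1 : v ^ δ ≤ 1 := Real.rpow_le_one hv.1 hv.2 hδ.le
    have hc0 : 0 ≤ |c| ^ δ := Real.rpow_nonneg (abs_nonneg c) _
    have hp0 : 0 ≤ pathInf z ^ (1 + δ) := Real.rpow_nonneg hp.1 _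
    rw [h3, norm_mul, Real.norm_eq_abs, Real.norm_eq_abs, abs_of_nonneg hp.1]
    calc _ ≤ pathInf z * (e * |ϑ| * (pathInf z * |c| * v) ^ δ) :=
          mul_le_mul_of_nonneg_left h2 hp.1
      _ = e * |ϑ| * (|c| ^ δ * v ^ δ * pathInf z ^ (1 + δ)) := by
          linear_combination e * |ϑ| * hpow z hp.1
      _ ≤ e * |ϑ| * (|c| ^ δ * 1 * pathInf z ^ (1 + δ)) := by gcongr
      _ = _ := by ring
  rw [integral_const_mul, ← constB_eq hδ hz, Real.norm_eq_abs] at h1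
  rw [e1, abs_mul, abs_of_pos (inv_pos.2 hA), abs_mul,
    abs_of_nonneg (Real.rpow_nonneg (abs_nonneg c) δ)]
  calc _ ≤ (constA Q)⁻¹ * (e * |ϑ| * |c| ^ δ * constB Q δ) := by gcongr
    _ = _ := by ring

/-- Mix the conditional densities over `Q` with Tonelli's theorem and extract the factor `|c| A`. -/
theorem restrict_map_obs [IsProbabilityMeasure μ] (hδ : 0 < δ) (hA : 0 < constA Q)
    (hz : ∀ᵐ z ∂Q, ∀ t, 0 ≤ z t ∧ z t ≤ m) (hμ0 : μ (Iio 0) = 0) (hh : Measurable h)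
    (hnn : ∀ u ∈ Icc 0 u₀, 0 ≤ h u)
    (hμ : μ.restrict (Icc 0 u₀)
      = ((volume : Measure ℝ).restrict (Icc 0 u₀)).withDensity fun u => ENNReal.ofReal (h u))
    (hr : ∀ u ∈ Icc 0 u₀, |h u - 1 - ϑ * u ^ δ| ≤ e * |ϑ| * u ^ δ) (he : 0 ≤ e)
    (hcm : |c| * m ≤ u₀) (hM : |c| < |M|) (hc : 0 < |c|) :
    ((μ.prod Q).map (obs M c)).restrict (Icc 0 1)
      = ((volume : Measure ℝ).restrict (Icc 0 1)).withDensity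
          fun v => ENNReal.ofReal (|c| * constA Q * (1 + relDens Q h c v)) := by
  ext s hs
  have hsI : MeasurableSet (s ∩ Icc 0 1) := hs.inter measurableSet_Icc
  have hp : ∀ᵐ z ∂Q, 0 ≤ pathInf z ∧ pathInf z * |c| ≤ u₀ := by
    filter_upwards [ae_pathInf_mem hz] with z hp
    exact ⟨hp.1, by simpa using (mul_mem_Icc_of_le hp hcm (v := 1) (by simp)).2⟩
  rw [Measure.restrict_apply hs, Measure.map_apply (measurable_obs M c) hsI,
    Measure.prod_apply_symm ((measurable_obs M c) hsI), withDensity_apply _ hs,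
    Measure.restrict_restrict hs]
  have h1 : ∫⁻ z, μ ((fun w => (w, z)) ⁻¹' (obs M c ⁻¹' (s ∩ Icc 0 1))) ∂Q
      = ∫⁻ z, (∫⁻ v in s ∩ Icc 0 1, ENNReal.ofReal (pathInf z * |c|) *
          ENNReal.ofReal (h (pathInf z * |c| * v))) ∂Q := by
    refine lintegral_congr_ae ?_
    filter_upwards [hp] with z hp
    exact measure_obs_mem hμ0 hh hμ hM hc hp.1 hp.2 hsI inter_subset_right
  have hI : Measurable fun y : C(unitInterval, ℝ) × ℝ => pathInf y.1 :=
    measurable_pathInf.comp measurable_fst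
  have hm1 : Measurable fun y : C(unitInterval, ℝ) × ℝ => pathInf y.1 * |c| := hI.mul_const _
  have hm2 : Measurable fun y : C(unitInterval, ℝ) × ℝ => h (pathInf y.1 * |c| * y.2) :=
    hh.comp (hm1.mul measurable_snd)
  rw [h1, lintegral_lintegral_swap (hm1.ennreal_ofReal.mul hm2.ennreal_ofReal).aemeasurable]
  refine setLIntegral_congr_fun hsI fun v hv => ?_
  have i1 := integrable_pathInf_mul hδ hz hh hr he hcm hv.2
  have i2 := integrable_pathInf hz
  have e1 : |c| * constA Q * (1 + relDens Q h c v)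
      = ∫ z, pathInf z * |c| * h (pathInf z * |c| * v) ∂Q := by
    have e2 : ∀ z, pathInf z * |c| * h (pathInf z * |c| * v)
        = |c| * (pathInf z + pathInf z * (h (pathInf z * |c| * v) - 1)) := fun z => by ring
    simp_rw [e2]
    rw [integral_const_mul, integral_add i2 i1, relDens]
    have : constA Q = ∫ z, pathInf z ∂Q := rfl
    rw [← this, mul_add, mul_one, mul_assoc |c|, mul_inv_cancel_left₀ hA.ne', mul_add]
  have i3 : Integrable (fun z => pathInf z * |c| * h (pathInf z * |c| * v)) Q := by
    refine ((i2.add i1).const_mul |c|).congr (ae_of_all _ fun z => ?_)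
    simp only [Pi.add_apply]
    ring
  rw [e1, ofReal_integral_eq_lintegral_ofReal i3]
  · refine lintegral_congr_ae ?_
    filter_upwards [hp] with z hp
    rw [ENNReal.ofReal_mul (mul_nonneg hp.1 hc.le)]
  · filter_upwards [ae_pathInf_mem hz] with z hp
    exact mul_nonneg (mul_nonneg hp.1 hc.le) (hnn _ (mul_mem_Icc_of_le hp hcm hv.2))

end Law

/-- The remainder condition excludes `ϑ = 0`, where the given density is one only almost everywhere.
Replacing it by the constant `1` lets one multiplicative bound cover `ϑ = 0` and `u = 0` as well. -/
theorem IsDeltaFamily.exists_density {δ : ℝ} {Θ : Set ℝ} {H : ℝ → Measure ℝ}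
    (hH : IsDeltaFamily δ Θ H) : ∃ (h : ℝ → ℝ → ℝ) (u₀ ε₀ : ℝ), 0 < u₀ ∧ 0 < ε₀ ∧
      (∀ ϑ ∈ Θ, Measurable (h ϑ) ∧ (∀ u ∈ Icc 0 u₀, 0 ≤ h ϑ u) ∧
        (H ϑ).restrict (Icc 0 u₀) = ((volume : Measure ℝ).restrict (Icc 0 u₀)).withDensity
          fun u => ENNReal.ofReal (h ϑ u)) ∧
      ∀ e > 0, ∃ u₁ > 0, u₁ ≤ u₀ ∧ ∀ ϑ ∈ Θ, |ϑ| ≤ ε₀ → ∀ u ∈ Icc 0 u₁,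
        |h ϑ u - 1 - ϑ * u ^ δ| ≤ e * |ϑ| * u ^ δ := by
  obtain ⟨h, u₀, ε₀, hu0, hu1, hε, hd, hr⟩ := hH.density
  refine ⟨fun ϑ => if ϑ = 0 then fun _ => 1 else h ϑ, u₀, ε₀, hu0, hε, fun ϑ hϑ => ?_,
    fun e he => ?_⟩
  · by_cases h0 : ϑ = 0
    · subst h0
      simp only [if_true]
      refine ⟨measurable_const, fun _ _ => zero_le_one, ?_⟩
      have : Icc 0 u₀ ∩ Ioo 0 1 = Ioc 0 u₀ := by
        ext u
        simp only [mem_inter_iff, mem_Icc, mem_Ioo, mem_Ioc]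
        exact ⟨fun hu => ⟨hu.2.1, hu.1.2⟩, fun hu => ⟨⟨hu.1.le, hu.2⟩, hu.1, hu.2.trans_lt hu1⟩⟩
      rw [hH.uniform, Measure.restrict_restrict measurableSet_Icc, this,
        Measure.restrict_congr_set (Ioc_ae_eq_Icc (μ := volume))]
      simp
    · simp only [h0, if_false]
      exact ⟨(hd ϑ hϑ).1, (hd ϑ hϑ).2.1, (hd ϑ hϑ).2.2.1⟩
  · rw [Metric.tendstoUniformlyOn_iff] at hr
    obtain ⟨u₁, hu₁, hsub⟩ := mem_nhdsGT_iff_exists_Ioo_subset.1 (hr e he)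
    have hu₁ : 0 < u₁ := hu₁
    -- The half turns the open interval supplied by the filter into a closed one.
    refine ⟨min u₀ (u₁ / 2), lt_min hu0 (half_pos hu₁), min_le_left _ _, fun ϑ hϑ hle u hu => ?_⟩
    by_cases h0 : ϑ = 0
    · simp [h0]
    simp only [h0, if_false]
    -- The limit `u ↓ 0` omits the endpoint; there the separate condition `r ϑ 0 = 0` is used.
    rcases hu.1.eq_or_lt with rfl | hpos
    · rw [(hd ϑ hϑ).2.2.2]
      simp only [abs_zero]
      positivity
    · have h1 := hsub ⟨hpos, (hu.2.trans (min_le_right _ _)).trans_lt (by linarith)⟩ ϑ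
        ⟨hϑ, abs_pos.2 h0, hle⟩
      have h2 : 0 < |ϑ| * u ^ δ := mul_pos (abs_pos.2 h0) (Real.rpow_pos_of_pos hpos _)
      rw [dist_zero_left, Real.norm_eq_abs, abs_div, abs_mul,
        abs_of_pos (Real.rpow_pos_of_pos hpos δ), div_lt_iff₀ h2] at h1
      rw [mul_assoc]
      exact h1.le

end GPPTest

/-! ### Expansion of the log-likelihood ratio for arrays uniform on `[0,1]` -/

namespace GPPTest

variable {Ω : Type*} [MeasurableSpace Ω]

/-- The sum of `φ` over those of the first `n` values which lie in `[0,1]`. -/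
noncomputable def excSum (n : ℕ) (v : ℕ → ℝ) (φ : ℝ → ℝ) : ℝ :=
  ∑ i ∈ Finset.range n, (Icc 0 1).indicator φ (v i)

theorem abs_indicator_le {φ : ℝ → ℝ} {C : ℝ} (hφ : ∀ v ∈ Icc (0:ℝ) 1, |φ v| ≤ C) (v : ℝ) :
    |(Icc 0 1).indicator φ v| ≤ C := by
  by_cases hv : v ∈ Icc (0:ℝ) 1
  · rw [indicator_of_mem hv]; exact hφ v hv
  · rw [indicator_of_notMem hv, abs_zero]
    exact (abs_nonneg _).trans (hφ 0 (by simp))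

theorem excSum_add (n : ℕ) (v : ℕ → ℝ) (φ ψ : ℝ → ℝ) :
    excSum n v (fun y => φ y + ψ y) = excSum n v φ + excSum n v ψ := by
  simp only [excSum, ← Finset.sum_add_distrib]
  refine Finset.sum_congr rfl fun i _ => ?_
  by_cases hv : v i ∈ Icc (0:ℝ) 1 <;> simp [hv]

theorem excSum_const_mul (n : ℕ) (v : ℕ → ℝ) (a : ℝ) (φ : ℝ → ℝ) :
    excSum n v (fun y => a * φ y) = a * excSum n v φ := by
  simp only [excSum, Finset.mul_sum]
  refine Finset.sum_congr rfl fun i _ => ?_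
  by_cases hv : v i ∈ Icc (0:ℝ) 1 <;> simp [hv]

theorem abs_excSum_le (n : ℕ) (v : ℕ → ℝ) {φ : ℝ → ℝ} {C : ℝ}
    (hφ : ∀ v ∈ Icc (0:ℝ) 1, |φ v| ≤ C) : |excSum n v φ| ≤ C * excSum n v fun _ => 1 := by
  rw [excSum, excSum, Finset.mul_sum]
  refine (Finset.abs_sum_le_sum_abs _ _).trans (Finset.sum_le_sum fun i _ => ?_)
  by_cases hv : v i ∈ Icc (0:ℝ) 1
  · simpa [hv] using hφ _ hv
  · simp [hv]

theorem excSum_one_nonneg (n : ℕ) (v : ℕ → ℝ) : 0 ≤ excSum n v fun _ => 1 :=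
  Finset.sum_nonneg fun _ _ => indicator_nonneg (fun _ _ => zero_le_one) _

theorem excSum_one_le (n : ℕ) (v : ℕ → ℝ) : (excSum n v fun _ => 1) ≤ n := by
  have h : ∀ i ∈ Finset.range n, (Icc (0:ℝ) 1).indicator (fun _ => (1:ℝ)) (v i) ≤ 1 := fun i _ =>
    indicator_le_self' (fun _ _ => zero_le_one) _
  simpa [excSum] using Finset.sum_le_sum h

theorem measurable_excSum {V : ℕ → Ω → ℝ} (hV : ∀ i, Measurable (V i)) {φ : ℝ → ℝ}
    (hφ : Measurable φ) (n : ℕ) : Measurable fun ω => excSum n (fun i => V i ω) φ :=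
  Finset.measurable_sum _ fun i _ => (hφ.indicator measurableSet_Icc).comp (hV i)

section Row

variable {P : Measure Ω} [IsProbabilityMeasure P] {V : ℕ → Ω → ℝ} {ν : Measure ℝ} {p C : ℝ}
  {φ : ℝ → ℝ}

theorem integral_indicator_Icc (hr : ν.restrict (Icc 0 1)
    = ENNReal.ofReal p • (volume : Measure ℝ).restrict (Icc 0 1)) (hp : 0 ≤ p) (φ : ℝ → ℝ) :
    ∫ x, (Icc 0 1).indicator φ x ∂ν = p * ∫ x in Icc 0 1, φ x := by
  rw [integral_indicator measurableSet_Icc, hr, integral_smul_measure, ENNReal.toReal_ofReal hp,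
    smul_eq_mul]

theorem setIntegral_Icc_le (hC : ∀ v ∈ Icc (0:ℝ) 1, |φ v| ≤ C) : |∫ x in Icc 0 1, φ x| ≤ C := by
  have h := norm_setIntegral_le_of_norm_le_const (μ := volume) (s := Icc (0:ℝ) 1) (f := φ) (C := C)
    (by simp) hC
  simpa using h

theorem integral_sq_excSum_sub_le (hV : ∀ i, Measurable (V i)) (hind : iIndepFun V P)
    (hν : ∀ i, P.map (V i) = ν) (hr : ν.restrict (Icc 0 1)
      = ENNReal.ofReal p • (volume : Measure ℝ).restrict (Icc 0 1)) (hp : 0 ≤ p)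
    (hφ : Measurable φ) (hC : ∀ v ∈ Icc (0:ℝ) 1, |φ v| ≤ C) (n : ℕ) :
    ∫ ω, (excSum n (fun i => V i ω) φ - n * p * ∫ x in Icc 0 1, φ x) ^ 2 ∂P ≤ n * p * C ^ 2 := by
  have h := integral_sq_sum_sub_le hV hind hν (hφ.indicator measurableSet_Icc)
    (abs_indicator_le hC) n
  have e : ∀ x, (Icc (0:ℝ) 1).indicator φ x ^ 2 = (Icc (0:ℝ) 1).indicator (fun v => φ v ^ 2) x :=
    fun x => by by_cases hx : x ∈ Icc (0:ℝ) 1 <;> simp [hx]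
  simp_rw [e, integral_indicator_Icc hr hp, ← mul_assoc] at h
  refine h.trans (mul_le_mul_of_nonneg_left ?_ (by positivity))
  refine (le_abs_self _).trans (setIntegral_Icc_le fun v hv => ?_)
  rw [abs_pow]
  exact pow_le_pow_left₀ (abs_nonneg _) (hC v hv) 2

theorem integrable_sq_excSum_sub (hV : ∀ i, Measurable (V i))
    (hφ : Measurable φ) (hC : ∀ v ∈ Icc (0:ℝ) 1, |φ v| ≤ C) (n : ℕ) (a : ℝ) :
    Integrable (fun ω => (excSum n (fun i => V i ω) φ - a) ^ 2) P := by
  have hm := measurable_excSum hV hφ n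
  have hC0 : 0 ≤ C := (abs_nonneg _).trans (hC 0 (by simp))
  refine Integrable.of_bound (Measurable.aestronglyMeasurable (by fun_prop)) ((C * n + |a|) ^ 2)
    (ae_of_all _ fun ω => ?_)
  rw [Real.norm_eq_abs, abs_pow]
  refine pow_le_pow_left₀ (abs_nonneg _) ((abs_sub _ _).trans (add_le_add_left ?_ _)) 2
  exact (abs_excSum_le n _ hC).trans (mul_le_mul_of_nonneg_left (excSum_one_le _ _) hC0)

theorem integrable_excSum_one (hV : ∀ i, Measurable (V i)) (n : ℕ) :
    Integrable (fun ω => excSum n (fun i => V i ω) fun _ => 1) P :=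
  Integrable.of_bound (measurable_excSum hV measurable_const n).aestronglyMeasurable n
    (ae_of_all _ fun ω => by
      rw [Real.norm_eq_abs, abs_of_nonneg (excSum_one_nonneg _ _)]
      exact excSum_one_le _ _)

theorem integral_excSum_one (hV : ∀ i, Measurable (V i)) (hν : ∀ i, P.map (V i) = ν)
    (hr : ν.restrict (Icc 0 1) = ENNReal.ofReal p • (volume : Measure ℝ).restrict (Icc 0 1))
    (hp : 0 ≤ p) (n : ℕ) : ∫ ω, (excSum n (fun i => V i ω) fun _ => 1) ∂P = n * p := by
  have hm : Measurable ((Icc (0:ℝ) 1).indicator fun _ => (1:ℝ)) :=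
    measurable_const.indicator measurableSet_Icc
  have h1 : ∀ i, ∫ ω, (Icc (0:ℝ) 1).indicator (fun _ => (1:ℝ)) (V i ω) ∂P = p := fun i => by
    rw [← integral_map (hV i).aemeasurable hm.aestronglyMeasurable, hν i,
      integral_indicator_Icc hr hp]
    simp
  unfold excSum
  rw [integral_finsetSum]
  · simp [h1]
  · intro i _
    refine Integrable.of_bound (hm.comp (hV i)).aestronglyMeasurable 1 (ae_of_all _ fun ω => ?_)
    exact abs_indicator_le (by simp) _

end Row

theorem setIntegral_Icc_rpow {a : ℝ} (ha : 0 ≤ a) : ∫ x in Icc (0:ℝ) 1, x ^ a = 1 / (a + 1) := by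
  rw [integral_Icc_eq_integral_Ioc, ← intervalIntegral.integral_of_le zero_le_one,
    integral_rpow (Or.inl (by linarith)), Real.one_rpow, Real.zero_rpow (by linarith), sub_zero]

theorem abs_log_one_add_sub_le {x : ℝ} (hx : |x| ≤ 1 / 2) :
    |Real.log (1 + x) - x + x ^ 2 / 2| ≤ 2 * |x| ^ 3 := by
  have h := Real.abs_log_sub_add_sum_range_le (x := -x) (by rw [abs_neg]; linarith) 2
  simp only [Finset.sum_range_succ, Finset.sum_range_zero, abs_neg, sub_neg_eq_add] at h
  have e : Real.log (1 + x) - x + x ^ 2 / 2 = 0 + (-x) ^ (0 + 1) / ((0:ℕ) + 1) +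
      (-x) ^ (1 + 1) / ((1:ℕ) + 1) + Real.log (1 + x) := by push_cast; ring
  rw [e]
  refine h.trans ?_
  rw [div_le_iff₀ (by linarith)]
  have : 0 ≤ |x| ^ 3 := by positivity
  norm_num
  nlinarith

theorem abs_log_one_sub_add_le {q : ℝ} (hq : |q| ≤ 1 / 2) :
    |Real.log (1 - q) + q| ≤ 2 * q ^ 2 := by
  have h := Real.abs_log_sub_add_sum_range_le (x := q) (by linarith) 1
  simp only [Finset.sum_range_succ, Finset.sum_range_zero] at h
  have e : Real.log (1 - q) + q = 0 + q ^ (0 + 1) / ((0:ℕ) + 1) + Real.log (1 - q) := by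
    push_cast; ring
  rw [e]
  refine h.trans ?_
  rw [div_le_iff₀ (by linarith)]
  norm_num
  nlinarith [sq_nonneg q]

/-- Row-wise i.i.d. arrays whose `n`-th row has density `p n → 0` on `[0,1]`, with
`n * p n → ∞`. -/
structure IsUniformArray (P : Measure Ω) (V : ℕ → ℕ → Ω → ℝ) (ν : ℕ → Measure ℝ) (p : ℕ → ℝ) :
    Prop where
  measurable : ∀ n i, Measurable (V n i)
  iIndepFun : ∀ n, iIndepFun (V n) P
  law : ∀ n i, P.map (V n i) = ν n
  pos : ∀ n, 0 < p n
  tendsto_zero : Tendsto p atTop (𝓝 0)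
  tendsto_atTop : Tendsto (fun n : ℕ => n * p n) atTop atTop
  restrict : ∀ᶠ n in atTop,
    (ν n).restrict (Icc 0 1) = ENNReal.ofReal (p n) • (volume : Measure ℝ).restrict (Icc 0 1)

section Array

variable {P : Measure Ω} [IsProbabilityMeasure P] {V : ℕ → ℕ → Ω → ℝ} {ν : ℕ → Measure ℝ}
  {p : ℕ → ℝ}

theorem IsUniformArray.tendstoInMeasure_sq (h : IsUniformArray P V ν p) {φ : ℕ → ℝ → ℝ}
    {C : ℕ → ℝ} {a : ℕ → ℝ} (hφ : ∀ n, Measurable (φ n))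
    (hC : ∀ᶠ n in atTop, ∀ v ∈ Icc (0:ℝ) 1, |φ n v| ≤ C n)
    (hlim : Tendsto (fun n : ℕ => a n ^ 2 * (n * p n * C n ^ 2)) atTop (𝓝 0)) :
    TendstoInMeasure P (fun n ω => a n * (excSum n (fun i => V n i ω) (φ n)
      - n * p n * ∫ x in Icc 0 1, φ n x)) atTop fun _ => 0 := by
  refine tendstoInMeasure_zero_of_integral_sq_le ?_ ?_ hlim
  · filter_upwards [hC] with n hn
    simp_rw [mul_pow]
    exact (integrable_sq_excSum_sub (h.measurable n) (hφ n) hn n _).const_mul _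
  · filter_upwards [hC, h.restrict] with n hn hr
    simp_rw [mul_pow]
    rw [integral_const_mul]
    exact mul_le_mul_of_nonneg_left (integral_sq_excSum_sub_le (h.measurable n) (h.iIndepFun n)
      (h.law n) hr (h.pos n).le (hφ n) hn n) (sq_nonneg _)

theorem IsUniformArray.tendstoInMeasure_abs (h : IsUniformArray P V ν p) {φ : ℕ → ℝ → ℝ}
    {C : ℕ → ℝ} (hC : ∀ᶠ n in atTop, ∀ v ∈ Icc (0:ℝ) 1, |φ n v| ≤ C n)
    (hlim : Tendsto (fun n : ℕ => n * p n * C n) atTop (𝓝 0)) :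
    TendstoInMeasure P (fun n ω => excSum n (fun i => V n i ω) (φ n)) atTop fun _ => 0 := by
  refine tendstoInMeasure_zero_of_integral_le
    (g := fun n ω => C n * excSum n (fun i => V n i ω) fun _ => 1) ?_
    (Eventually.of_forall fun n => (integrable_excSum_one (h.measurable n) n).const_mul _) ?_ hlim
  · filter_upwards [hC] with n hn
    exact ae_of_all _ fun ω => abs_excSum_le _ _ hn
  · filter_upwards [h.restrict] with n hr
    rw [integral_const_mul, integral_excSum_one (h.measurable n) (h.law n) hr (h.pos n).le]
    exact (mul_comm _ _).le

/-- Expansion of the log likelihood ratio of the exceedances. -/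
theorem IsUniformArray.tendstoInMeasure_logDens (h : IsUniformArray P V ν p) {δ b κ : ℝ}
    (hδ : 0 < δ) (hb : 0 ≤ b) {η e : ℕ → ℝ} {x : ℕ → ℝ → ℝ} {l : ℕ → ℝ}
    (hη : ∀ᶠ n in atTop, η n ^ 2 * (n * p n) = κ) (he : Tendsto e atTop (𝓝 0))
    (hx : ∀ n, Measurable (x n))
    (hxe : ∀ᶠ n in atTop, ∀ v ∈ Icc (0:ℝ) 1, |x n v - η n * b * v ^ δ| ≤ e n * |η n|)
    (hl : ∀ᶠ n in atTop, l n = Real.log (1 - p n / (1 - p n) * ∫ v in Icc 0 1, x n v)) :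
    TendstoInMeasure P (fun n ω => ∑ i ∈ Finset.range n, logDens (l n) (x n) (V n i ω)
      - (η n * b * (excSum n (fun i => V n i ω) (fun v => v ^ δ) - n * p n / (1 + δ))
        - κ * b ^ 2 / (2 * (2 * δ + 1)))) atTop fun _ => 0 := by
  -- Since `η² n p` is eventually constant and `n p → ∞`, `η` must tend to zero.
  have hη0 : Tendsto (fun n => |η n|) atTop (𝓝 0) := by
    have h1 : Tendsto (fun n : ℕ => √(κ / (n * p n))) atTop (𝓝 0) := by
      simpa using (h.tendsto_atTop.const_div_atTop κ).sqrt
    refine h1.congr' ?_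
    filter_upwards [hη, h.tendsto_atTop.eventually_gt_atTop 0] with n h2 h3
    rw [← h2, mul_div_cancel_right₀ _ h3.ne', Real.sqrt_sq_eq_abs]
  have hpow : ∀ v ∈ Icc (0:ℝ) 1, 0 ≤ v ^ δ ∧ v ^ δ ≤ 1 := fun v hv =>
    ⟨Real.rpow_nonneg hv.1 _, Real.rpow_le_one hv.1 hv.2 hδ.le⟩
  have hxC : ∀ᶠ n in atTop, ∀ v ∈ Icc (0:ℝ) 1, |x n v| ≤ (b + 1) * |η n| := by
    filter_upwards [hxe, he.eventually_le_const zero_lt_one] with n h1 h2 v hv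
    have h3 := hpow v hv
    calc |x n v| = |(x n v - η n * b * v ^ δ) + η n * b * v ^ δ| := by ring_nf
      _ ≤ |x n v - η n * b * v ^ δ| + |η n * b * v ^ δ| := abs_add_le _ _
      _ = |x n v - η n * b * v ^ δ| + |η n| * b * v ^ δ := by
          rw [abs_mul, abs_mul, abs_of_nonneg hb, abs_of_nonneg h3.1]
      _ ≤ 1 * |η n| + |η n| * b * 1 := by
          gcongr
          · exact (h1 v hv).trans (by gcongr)
          · exact h3.2
      _ = _ := by ring
  have hxhalf : ∀ᶠ n in atTop, (b + 1) * |η n| ≤ 1 / 2 := by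
    have h1 : Tendsto (fun n => (b + 1) * |η n|) atTop (𝓝 0) := by simpa using hη0.const_mul (b + 1)
    exact h1.eventually_le_const (by norm_num)
  have hp : ∀ᶠ n in atTop, p n ≤ 1 / 2 := h.tendsto_zero.eventually_le_const (by norm_num)
  -- `q` is the relative loss of mass outside `[0,1]`, so that `l = log (1 - q)`; it is of order `p
  -- |η|`.
  set q : ℕ → ℝ := fun n => p n / (1 - p n) * ∫ v in Icc 0 1, x n v with hq
  have hqb : ∀ᶠ n in atTop, |q n| ≤ 2 * p n * ((b + 1) * |η n|) := by
    filter_upwards [hxC, hp] with n h1 h2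
    have h3 := h.pos n
    have h4 : p n / (1 - p n) ≤ 2 * p n := by
      rw [div_le_iff₀ (by linarith)]; nlinarith
    rw [hq, abs_mul, abs_of_nonneg (div_nonneg h3.le (by linarith))]
    exact mul_le_mul h4 (setIntegral_Icc_le h1) (abs_nonneg _) (by linarith)
  have hq2 : ∀ᶠ n in atTop, q n ^ 2 ≤ 4 * (b + 1) ^ 2 * η n ^ 2 * p n ^ 2 := by
    filter_upwards [hqb] with n h1
    rw [← sq_abs (q n)]
    calc |q n| ^ 2 ≤ (2 * p n * ((b + 1) * |η n|)) ^ 2 := pow_le_pow_left₀ (abs_nonneg _) h1 2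
      _ = 4 * (b + 1) ^ 2 * |η n| ^ 2 * p n ^ 2 := by ring
      _ = _ := by rw [sq_abs]
  -- the remainder of the second order expansion of the logarithm
  have t1 := h.tendstoInMeasure_abs
    (φ := fun n v => Real.log (1 + x n v) - x n v + η n ^ 2 * b ^ 2 / 2 * (v ^ δ) ^ 2)
    (C := fun n => η n ^ 2 * (2 * (b + 1) ^ 3 * |η n| + (b + 1) * e n)) (by
      filter_upwards [hxC, hxe, hxhalf] with n h1 h2 h3 v hv
      have h4 := hpow v hv
      have h5 := abs_log_one_add_sub_le ((h1 v hv).trans h3)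
      have h6 : |x n v| ^ 3 ≤ ((b + 1) * |η n|) ^ 3 := pow_le_pow_left₀ (abs_nonneg _) (h1 v hv) 3
      have h7 : |x n v + η n * b * v ^ δ| ≤ 2 * ((b + 1) * |η n|) := by
        refine (abs_add_le _ _).trans ?_
        rw [abs_mul, abs_mul, abs_of_nonneg hb, abs_of_nonneg h4.1]
        have h8 : |η n| * b * v ^ δ ≤ |η n| * b * 1 :=
          mul_le_mul_of_nonneg_left h4.2 (by positivity)
        linarith [h1 v hv, abs_nonneg (η n)]
      have h8 : |x n v ^ 2 - η n ^ 2 * b ^ 2 * (v ^ δ) ^ 2|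
          ≤ (e n * |η n|) * (2 * ((b + 1) * |η n|)) := by
        have : x n v ^ 2 - η n ^ 2 * b ^ 2 * (v ^ δ) ^ 2
            = (x n v - η n * b * v ^ δ) * (x n v + η n * b * v ^ δ) := by ring
        rw [this, abs_mul]
        exact mul_le_mul (h2 v hv) h7 (abs_nonneg _) ((abs_nonneg _).trans (h2 v hv))
      have h9 : Real.log (1 + x n v) - x n v + η n ^ 2 * b ^ 2 / 2 * (v ^ δ) ^ 2
          = (Real.log (1 + x n v) - x n v + x n v ^ 2 / 2)
            - (x n v ^ 2 - η n ^ 2 * b ^ 2 * (v ^ δ) ^ 2) / 2 := by ring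
      rw [h9]
      refine (abs_sub _ _).trans ?_
      rw [abs_div, abs_two]
      calc _ ≤ 2 * ((b + 1) * |η n|) ^ 3 + e n * |η n| * (2 * ((b + 1) * |η n|)) / 2 := by linarith
        _ = |η n| ^ 2 * (2 * (b + 1) ^ 3 * |η n| + (b + 1) * e n) := by ring
        _ = _ := by rw [sq_abs]) (by
      have h1 : Tendsto (fun n => κ * (2 * (b + 1) ^ 3 * |η n| + (b + 1) * e n)) atTop (𝓝 0) := by
        simpa using ((hη0.const_mul (2 * (b + 1) ^ 3)).add (he.const_mul (b + 1))).const_mul κ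
      refine h1.congr' ?_
      filter_upwards [hη] with n h2
      rw [← h2]; ring)
  have hmpow : Measurable fun v : ℝ => v ^ δ := measurable_id.pow_const δ
  -- Only the fluctuation of this remainder is small: its second moment is at most `n p (e η)² = κ
  -- e²`. Its mean is kept and cancels at the end against the contribution of the non-exceedances.
  have t2 := h.tendstoInMeasure_sq (φ := fun n v => x n v - η n * b * v ^ δ)
    (C := fun n => e n * |η n|) (a := fun _ => 1)
    (fun n => (hx n).sub (hmpow.const_mul _)) hxe (by
      have h1 : Tendsto (fun n => κ * e n ^ 2) atTop (𝓝 0) := by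
        simpa using (he.pow 2).const_mul κ
      refine h1.congr' ?_
      filter_upwards [hη] with n h2
      rw [← h2, mul_pow, sq_abs]; ring)
  have t3 := h.tendstoInMeasure_sq (φ := fun _ v => (v ^ δ) ^ 2)
    (C := fun _ => 1) (a := fun n => -(η n ^ 2 * b ^ 2 / 2))
    (fun n => hmpow.pow_const 2) (Eventually.of_forall fun n v hv => by
      rw [abs_of_nonneg (sq_nonneg _)]
      exact pow_le_one₀ (hpow v hv).1 (hpow v hv).2) (by
      have h1 : Tendsto (fun n => κ * b ^ 4 / 4 * |η n| ^ 2) atTop (𝓝 0) := by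
        simpa using (hη0.pow 2).const_mul (κ * b ^ 4 / 4)
      refine h1.congr' ?_
      filter_upwards [hη] with n h2
      rw [← h2, sq_abs]; ring)
  -- This permits replacing `q τ` by its mean `q n p`; the squared error is of order `q² n p = O(κ
  -- p²)`.
  have t4 := h.tendstoInMeasure_sq (φ := fun _ _ => 1) (C := fun _ => 1) (a := q)
    (fun n => measurable_const) (Eventually.of_forall fun n v hv => abs_one.le) (by
      have h1 : Tendsto (fun n => 4 * (b + 1) ^ 2 * κ * p n ^ 2) atTop (𝓝 0) := by
        simpa using (h.tendsto_zero.pow 2).const_mul (4 * (b + 1) ^ 2 * κ)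
      refine squeeze_zero' ?_ ?_ h1
      · refine Eventually.of_forall fun n => ?_
        have := (h.pos n).le
        positivity
      · filter_upwards [hη, hq2] with n h2 h3
        have := (h.pos n).le
        calc q n ^ 2 * (n * p n * 1 ^ 2)
            ≤ 4 * (b + 1) ^ 2 * η n ^ 2 * p n ^ 2 * (n * p n * 1 ^ 2) := by gcongr
          _ = _ := by rw [← h2]; ring)
  -- Linearizing `log (1 - q)` costs `O(q²)` for each non-exceedance, altogether `O(n q²) = O(κ p)`.
  have t5 : TendstoInMeasure P (fun n ω => (n - excSum n (fun i => V n i ω) fun _ => 1)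
      * (Real.log (1 - q n) + q n)) atTop fun _ => 0 := by
    refine tendstoInMeasure_zero_of_integral_le (g := fun n _ => 8 * (b + 1) ^ 2 * κ * p n)
      (b := fun n => 8 * (b + 1) ^ 2 * κ * p n) ?_
      (Eventually.of_forall fun n => integrable_const _)
      (Eventually.of_forall fun n => by rw [integral_const, probReal_univ, one_smul])
      (by simpa using h.tendsto_zero.const_mul (8 * (b + 1) ^ 2 * κ))
    filter_upwards [hη, hq2, hqb, hxhalf, hp] with n h1 h2 h3 h4 h5
    refine ae_of_all _ fun ω => ?_
    have hp0 := (h.pos n).le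
    have h6 : |q n| ≤ 1 / 2 := by
      refine h3.trans ?_
      have : 0 ≤ (b + 1) * |η n| := by positivity
      nlinarith
    have h7 := abs_log_one_sub_add_le h6
    have h8 := excSum_one_nonneg n fun i => V n i ω
    have h9 := excSum_one_le n fun i => V n i ω
    rw [abs_mul, abs_of_nonneg (by linarith)]
    calc _ ≤ (n : ℝ) * (2 * (4 * (b + 1) ^ 2 * η n ^ 2 * p n ^ 2)) := by
          refine mul_le_mul (by linarith) (h7.trans (by linarith)) (abs_nonneg _) (by positivity)
      _ = _ := by rw [← h1]; ring
  have htot := tendstoInMeasure_zero_add t1 (tendstoInMeasure_zero_add t2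
    (tendstoInMeasure_zero_add t3 (tendstoInMeasure_zero_add t4 t5)))
  refine tendstoInMeasure_zero_of_le (E := fun _ => ∅) (by simp) htot ?_
  filter_upwards [hη, hl, hp, hxC] with n h1 h2 h3 h4
  refine ae_of_all _ fun ω _ => (le_of_eq ?_)
  congr 1
  have e1 : ∑ i ∈ Finset.range n, logDens (l n) (x n) (V n i ω)
      = n * l n + excSum n (fun i => V n i ω) (fun v => Real.log (1 + x n v) + -l n * 1) := by
    simp only [logDens, Finset.sum_add_distrib, Finset.sum_const, Finset.card_range, nsmul_eq_mul,
      excSum, mul_one, sub_eq_add_neg]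
  rw [excSum_add, excSum_const_mul] at e1
  have e2 : excSum n (fun i => V n i ω) (fun v => Real.log (1 + x n v))
      = excSum n (fun i => V n i ω) (fun v => Real.log (1 + x n v) - x n v
          + η n ^ 2 * b ^ 2 / 2 * (v ^ δ) ^ 2)
        + (excSum n (fun i => V n i ω) (fun v => x n v - η n * b * v ^ δ)
        + (η n * b * excSum n (fun i => V n i ω) (fun v => v ^ δ)
        + -(η n ^ 2 * b ^ 2 / 2) * excSum n (fun i => V n i ω) (fun v => (v ^ δ) ^ 2))) := by
    rw [← excSum_const_mul, ← excSum_const_mul, ← excSum_add, ← excSum_add, ← excSum_add]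
    congr 1
    funext v
    ring
  have e3 : ∫ v in Icc (0:ℝ) 1, (v ^ δ) ^ 2 = 1 / (2 * δ + 1) := by
    rw [← setIntegral_Icc_rpow (by linarith)]
    refine setIntegral_congr_fun measurableSet_Icc fun v hv => ?_
    rw [← Real.rpow_natCast, ← Real.rpow_mul hv.1]
    congr 1
    push_cast; ring
  have e4 : ∫ v in Icc (0:ℝ) 1, (x n v - η n * b * v ^ δ)
      = (∫ v in Icc (0:ℝ) 1, x n v) - η n * b * (1 / (δ + 1)) := by
    rw [integral_sub, integral_const_mul, setIntegral_Icc_rpow hδ.le]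
    · exact Measure.integrableOn_of_bounded (by simp) (hx n).aestronglyMeasurable
        ((ae_restrict_iff' measurableSet_Icc).2 (ae_of_all _ h4))
    · refine Integrable.const_mul ?_ _
      refine Measure.integrableOn_of_bounded (M := 1) (by simp) hmpow.aestronglyMeasurable
        ((ae_restrict_iff' measurableSet_Icc).2 (ae_of_all _ fun v hv => ?_))
      rw [Real.norm_eq_abs, abs_of_nonneg (hpow v hv).1]
      exact (hpow v hv).2
  have e5 : q n * (1 - p n) = p n * ∫ v in Icc (0:ℝ) 1, x n v := by
    have : 1 - p n ≠ 0 := by linarith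
    rw [hq]
    field_simp
  have e6 : ∫ _ in Icc (0:ℝ) 1, (1:ℝ) = 1 := by simp
  have e7 : Real.log (1 - q n) = l n := h2.symm
  have e8 : η n ^ 2 * (n * p n) * b ^ 2 / (2 * (2 * δ + 1))
      = η n ^ 2 * (n * p n) * b ^ 2 * (1 / (2 * δ + 1)) / 2 := by field_simp
  rw [e1, e2, e3, e4, e6, e7, ← h1, e8, add_comm 1 δ]
  -- What remains is the cancellation of means: `-n q + q n p = -n p ∫ x`, which is `e5` multiplied
  -- by `-n`.
  linear_combination (-(n:ℝ)) * e5
end Array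

end GPPTest

/-! ### Joint limit of the exceedance count and the normalized sum -/

namespace GPPTest

variable {Ω : Type*} [MeasurableSpace Ω]

theorem setIntegral_Icc_rpow_sub {δ : ℝ} (hδ : 0 < δ) :
    ∫ v in Icc (0:ℝ) 1, (v ^ δ - 1 / (1 + δ)) = 0 := by
  have i1 : IntegrableOn (fun v : ℝ => v ^ δ) (Icc 0 1) :=
    (Real.continuous_rpow_const hδ.le).integrableOn_Icc
  rw [integral_sub i1 (by simp), setIntegral_Icc_rpow hδ.le]
  simp [add_comm]

theorem setIntegral_Icc_rpow_sub_sq {δ : ℝ} (hδ : 0 < δ) :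
    ∫ v in Icc (0:ℝ) 1, (v ^ δ - 1 / (1 + δ)) ^ 2 = δ ^ 2 / ((2 * δ + 1) * (1 + δ) ^ 2) := by
  have i1 : IntegrableOn (fun v : ℝ => v ^ (2 * δ)) (Icc 0 1) :=
    (Real.continuous_rpow_const (by linarith)).integrableOn_Icc
  have i2 : IntegrableOn (fun v : ℝ => 2 / (1 + δ) * (v ^ δ - 1 / (1 + δ))) (Icc 0 1) :=
    (((Real.continuous_rpow_const hδ.le).sub continuous_const).const_mul _).integrableOn_Icc
  -- Expanded so that the cross term is a multiple of the centred power and integrates to zero.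
  have e : ∀ v ∈ Icc (0:ℝ) 1, (v ^ δ - 1 / (1 + δ)) ^ 2
      = v ^ (2 * δ) - 2 / (1 + δ) * (v ^ δ - 1 / (1 + δ)) - 1 / (1 + δ) ^ 2 := fun v hv => by
    have : v ^ (2 * δ) = (v ^ δ) ^ 2 := by
      rw [← Real.rpow_natCast, ← Real.rpow_mul hv.1, mul_comm]; norm_num
    rw [this]
    field_simp
    ring
  have i3 : IntegrableOn (fun v : ℝ => v ^ (2 * δ) - 2 / (1 + δ) * (v ^ δ - 1 / (1 + δ)))
    (Icc 0 1) := i1.sub i2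
  rw [setIntegral_congr_fun measurableSet_Icc e, integral_sub i3 (by simp), integral_sub i1 i2,
    integral_const_mul, setIntegral_Icc_rpow_sub hδ, setIntegral_Icc_rpow (by linarith)]
  simp only [integral_const, MeasurableSet.univ, measureReal_restrict_apply, univ_inter,
    Real.volume_real_Icc, sub_zero, smul_eq_mul]
  field_simp
  norm_num
  ring

theorem abs_rpow_sub_le {δ : ℝ} (hδ : 0 < δ) : ∀ v ∈ Icc (0:ℝ) 1, |v ^ δ - 1 / (1 + δ)| ≤ 1 := by
  intro v hv
  have h1 := Real.rpow_nonneg hv.1 δ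
  have h2 := Real.rpow_le_one hv.1 hv.2 hδ.le
  have h3 : 1 / (1 + δ) ≤ 1 := (div_le_one (by linarith)).2 (by linarith)
  have h4 : 0 ≤ 1 / (1 + δ) := by positivity
  rw [abs_le]
  constructor <;> linarith

theorem IsUniformArray.tendsto_inv_sqrt {P : Measure Ω} {V : ℕ → ℕ → Ω → ℝ}
    {ν : ℕ → Measure ℝ} {p : ℕ → ℝ} (h : IsUniformArray P V ν p) :
    Tendsto (fun n : ℕ => (√(n * p n))⁻¹) atTop (𝓝 0) :=
  (Real.tendsto_sqrt_atTop.comp h.tendsto_atTop).inv_tendsto_atTop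

section Array

variable {P : Measure Ω} [IsProbabilityMeasure P] {V : ℕ → ℕ → Ω → ℝ} {ν : ℕ → Measure ℝ}
  {p : ℕ → ℝ} {δ : ℝ}

theorem IsUniformArray.tendstoInDistribution_pair (h : IsUniformArray P V ν p) (hδ : 0 < δ) :
    TendstoInDistribution (fun n ω =>
      ((√(n * p n))⁻¹ * ((excSum n (fun i => V n i ω) fun _ => 1) - n * p n),
        (√(n * p n))⁻¹ * (1 + δ) * excSum n (fun i => V n i ω) fun v => v ^ δ - 1 / (1 + δ)))
      atTop id (fun _ => P)
      ((gaussianReal 0 1).prod (gaussianReal 0 (δ ^ 2 / (2 * δ + 1)).toNNReal)) := by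
  have hprob : ∀ n, IsProbabilityMeasure (ν n) := fun n => by
    rw [← h.law n 0]; exact Measure.isProbabilityMeasure_map (h.measurable n 0).aemeasurable
  set I : ℝ → ℝ := (Icc (0:ℝ) 1).indicator fun _ => 1 with hI
  set G : ℝ → ℝ := (Icc (0:ℝ) 1).indicator fun v => v ^ δ - 1 / (1 + δ) with hG
  have mI : Measurable I := measurable_const.indicator measurableSet_Icc
  have mG : Measurable G :=
    ((measurable_id.pow_const δ).sub_const _).indicator measurableSet_Icc
  have bI : ∀ v, |I v| ≤ 1 := abs_indicator_le fun _ _ => abs_one.le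
  have bG : ∀ v, |G v| ≤ 1 := abs_indicator_le (abs_rpow_sub_le hδ)
  have iI : ∀ n, Integrable I (ν n) := fun n =>
    Integrable.of_bound mI.aestronglyMeasurable 1 (ae_of_all _ bI)
  have sI : ∀ᶠ n in atTop, ∫ v, I v ∂ν n = p n := by
    filter_upwards [h.restrict] with n hr
    rw [hI, integral_indicator_Icc hr (h.pos n).le]
    simp
  have sG : ∀ᶠ n in atTop, ∫ v, G v ∂ν n = 0 := by
    filter_upwards [h.restrict] with n hr
    rw [hG, integral_indicator_Icc hr (h.pos n).le, setIntegral_Icc_rpow_sub hδ, mul_zero]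
  have sG2 : ∀ᶠ n in atTop, ∫ v, G v ^ 2 ∂ν n
      = p n * (δ ^ 2 / ((2 * δ + 1) * (1 + δ) ^ 2)) := by
    filter_upwards [h.restrict] with n hr
    rw [← setIntegral_Icc_rpow_sub_sq hδ, ← integral_indicator_Icc hr (h.pos n).le]
    refine integral_congr_ae (ae_of_all _ fun v => ?_)
    by_cases hv : v ∈ Icc (0:ℝ) 1 <;> simp [G, hv]
  have hN : ∀ᶠ n : ℕ in atTop, 0 < n * p n := h.tendsto_atTop.eventually_gt_atTop 0
  have hsq : ∀ n : ℕ, 0 < n * p n → (√(n * p n))⁻¹ ^ 2 = (n * p n)⁻¹ := fun n hn => by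
    rw [inv_pow, Real.sq_sqrt hn.le]
  have hv : 0 ≤ δ ^ 2 / (2 * δ + 1) := by positivity
  have key := tendstoInDistribution_row_sums h.measurable h.iIndepFun h.law
    (φ := fun n v => (√(n * p n))⁻¹ * (I v - p n)) (ψ := fun n v => (√(n * p n))⁻¹ * (1 + δ) * G v)
    (K := fun n => (√(n * p n))⁻¹ * (1 + δ + p n)) (a := 1) (b := (δ ^ 2 / (2 * δ + 1)).toNNReal)
    (fun n => (mI.sub_const _).const_mul _) (fun n => mG.const_mul _) (fun n v => by
      rw [abs_mul, abs_of_nonneg (by positivity : (0:ℝ) ≤ (√(n * p n))⁻¹)]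
      gcongr
      refine (abs_sub _ _).trans ?_
      rw [abs_of_pos (h.pos n)]
      linarith [bI v]) (fun n v => by
      have := h.pos n
      rw [abs_mul, abs_mul, abs_of_nonneg (by positivity : (0:ℝ) ≤ (√(n * p n))⁻¹),
        abs_of_pos (by linarith : 0 < 1 + δ), mul_assoc]
      gcongr
      nlinarith [bG v]) (by
      simpa using h.tendsto_inv_sqrt.mul (h.tendsto_zero.const_add (1 + δ))) (by
      filter_upwards [sI] with n hn
      rw [integral_const_mul, integral_sub (iI n) (integrable_const _), hn]
      simp) (by
      filter_upwards [sG] with n hn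
      rw [integral_const_mul, hn, mul_zero]) (by
      -- The count is a sum of Bernoulli variables: `n * (n p)⁻¹ * p (1 - p) = 1 - p`.
      have h1 : Tendsto (fun n => 1 - p n) atTop (𝓝 ((1 : NNReal) : ℝ)) := by
        simpa using h.tendsto_zero.const_sub 1
      refine h1.congr' ?_
      filter_upwards [sI, hN] with n hn hN
      have e : ∀ v, ((√(n * p n))⁻¹ * (I v - p n)) ^ 2
          = (n * p n)⁻¹ * ((1 - 2 * p n) * I v + p n ^ 2) := fun v => by
        have : I v ^ 2 = I v := by by_cases hv : v ∈ Icc (0:ℝ) 1 <;> simp [I, hv]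
        rw [mul_pow, hsq n hN]
        linear_combination (n * p n)⁻¹ * this
      simp_rw [e]
      rw [integral_const_mul, integral_add ((iI n).const_mul _) (integrable_const _),
        integral_const_mul, hn, integral_const, probReal_univ, one_smul, ← mul_assoc]
      have : (n:ℝ) * (n * p n)⁻¹ = (p n)⁻¹ := by
        have h3 : (n:ℝ) ≠ 0 := fun h0 => by simp [h0] at hN
        rw [mul_inv, ← mul_assoc, mul_inv_cancel₀ h3, one_mul]
      rw [this]
      have := (h.pos n).ne'
      field_simp
      ring) (by
      rw [Real.coe_toNNReal _ hv]
      refine tendsto_const_nhds.congr' ?_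
      filter_upwards [sG2, hN] with n hn hN
      simp_rw [mul_pow]
      rw [integral_const_mul, hn, hsq n hN]
      have h3 : (n:ℝ) ≠ 0 := fun h0 => by simp [h0] at hN
      have := (h.pos n).ne'
      field_simp) (by
      -- Since `I * G = G`, the cross moment is a multiple of `∫ G = 0`: the components are exactly
      -- uncorrelated as soon as the law on `[0,1]` is uniform.
      refine tendsto_const_nhds.congr' ?_
      filter_upwards [sG] with n hn
      have e : ∀ v, (√(n * p n))⁻¹ * (I v - p n) * ((√(n * p n))⁻¹ * (1 + δ) * G v)
          = (√(n * p n))⁻¹ ^ 2 * (1 + δ) * (1 - p n) * G v := fun v => by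
        have : I v * G v = G v := by by_cases hv : v ∈ Icc (0:ℝ) 1 <;> simp [I, G, hv]
        linear_combination (√(n * p n))⁻¹ ^ 2 * (1 + δ) * this
      simp_rw [e]
      rw [integral_const_mul, hn]
      simp)
  convert key using 4 with n ω
  · simp only [excSum, ← Finset.mul_sum, Finset.sum_sub_distrib, Finset.sum_const,
      Finset.card_range, nsmul_eq_mul]
    rfl
  · simp only [excSum, ← Finset.mul_sum]
    rfl

/-- The difference equals `(t - N) / ((√t + √N) √N √t)`, and `t ≥ N / 2` gives `√N ≤ 2 √t`, which
bounds the denominator from below. -/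
theorem abs_inv_sqrt_sub_inv_sqrt_le {N t : ℝ} (hN : 0 < N) (ht : |t - N| ≤ N / 2) :
    |(√N)⁻¹ - (√t)⁻¹| ≤ 2 * |t - N| / (N * √N) := by
  have h1 := abs_le.1 ht
  have ht0 : 0 < t := by linarith
  have hs := Real.sqrt_pos.2 hN
  have hr := Real.sqrt_pos.2 ht0
  have e1 := Real.sq_sqrt hN.le
  have e2 := Real.sq_sqrt ht0.le
  have h2 : √N ≤ 2 * √t := by
    rw [← abs_of_pos hs, ← abs_of_pos (by linarith : 0 < 2 * √t)]
    refine sq_le_sq.1 ?_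
    rw [mul_pow, e1, e2]
    linarith
  have h3 : (√N)⁻¹ - (√t)⁻¹ = (t - N) / ((√t + √N) * (√N * √t)) := by
    have : t - N = (√t - √N) * (√t + √N) := by linear_combination e1 - e2
    rw [this]
    field_simp
  have h4 : N * √N ≤ 2 * ((√t + √N) * (√N * √t)) := by
    have h5 : N ≤ (√t + √N) * √N := by nlinarith
    calc N * √N ≤ ((√t + √N) * √N) * (2 * √t) := by gcongr
      _ = _ := by ring
  rw [h3, abs_div, abs_of_pos (by positivity : 0 < (√t + √N) * (√N * √t)),
    div_le_div_iff₀ (by positivity) (by positivity)]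
  nlinarith [abs_nonneg (t - N)]

/-- Replacing the mean number of exceedances by the actual number changes the normalized sum only
by a term that vanishes in probability. -/
theorem IsUniformArray.tendstoInMeasure_renormalize (h : IsUniformArray P V ν p) (hδ : 0 < δ) :
    TendstoInMeasure P (fun n ω => (1 + δ) / √(excSum n (fun i => V n i ω) fun _ => 1)
          * (excSum n (fun i => V n i ω) fun v => v ^ δ - 1 / (1 + δ))
        - (√(n * p n))⁻¹ * (1 + δ) * excSum n (fun i => V n i ω) fun v => v ^ δ - 1 / (1 + δ))
      atTop fun _ => 0 := by
  have hN : ∀ᶠ n : ℕ in atTop, 0 < n * p n := h.tendsto_atTop.eventually_gt_atTop 0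
  have mG : Measurable fun v : ℝ => v ^ δ - 1 / (1 + δ) := (measurable_id.pow_const δ).sub_const _
  have i1 : ∀ n : ℕ, Integrable
      (fun ω => ((excSum n (fun i => V n i ω) fun _ => 1) - n * p n) ^ 2) P := fun n =>
    integrable_sq_excSum_sub (h.measurable n) measurable_const (fun _ _ => abs_one.le) n _
  have i2 : ∀ n : ℕ, Integrable
      (fun ω => (excSum n (fun i => V n i ω) fun v => v ^ δ - 1 / (1 + δ)) ^ 2) P := fun n => by
    simpa using integrable_sq_excSum_sub (P := P) (h.measurable n) mG (abs_rpow_sub_le hδ) n 0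
  have b1 : ∀ᶠ n : ℕ in atTop,
      ∫ ω, ((excSum n (fun i => V n i ω) fun _ => 1) - n * p n) ^ 2 ∂P ≤ n * p n := by
    filter_upwards [h.restrict] with n hr
    simpa using integral_sq_excSum_sub_le (h.measurable n) (h.iIndepFun n) (h.law n) hr
      (h.pos n).le (φ := fun _ => 1) measurable_const (fun _ _ => abs_one.le) n
  have b2 : ∀ᶠ n : ℕ in atTop,
      ∫ ω, (excSum n (fun i => V n i ω) fun v => v ^ δ - 1 / (1 + δ)) ^ 2 ∂P ≤ n * p n := by
    filter_upwards [h.restrict] with n hr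
    have := integral_sq_excSum_sub_le (h.measurable n) (h.iIndepFun n) (h.law n) hr
      (h.pos n).le mG (abs_rpow_sub_le hδ) n
    rw [setIntegral_Icc_rpow_sub hδ] at this
    simpa using this
  -- Chebyshev: with `N = n p`, the event `|τ - N| ≥ N / 2` has probability tending to zero. Off it
  -- `τ` is positive and comparable to `N`.
  have hE := tendsto_measure_ge_of_integral_le (P := P) (ε := 1 / 4)
    (g := fun (n : ℕ) ω => (n * p n)⁻¹ ^ 2 *
      ((excSum n (fun i => V n i ω) fun _ => 1) - n * p n) ^ 2)
    (b := fun n => (n * p n)⁻¹)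
    (Eventually.of_forall fun n => ae_of_all _ fun ω => by positivity)
    (Eventually.of_forall fun n => (i1 n).const_mul _) (by
      filter_upwards [b1, hN] with n h1 h2
      rw [integral_const_mul]
      calc _ ≤ (n * p n)⁻¹ ^ 2 * (n * p n) := by gcongr
        _ = _ := by field_simp) h.tendsto_atTop.inv_tendsto_atTop (by norm_num)
  -- The error is a product `|S| |τ - N|`, where `S` is the centred sum. Bounding it by `S² + (τ -
  -- N)²` leaves two second moments of size at most `N`, hence an expectation of order `N^(-1/2)`.
  have hg : TendstoInMeasure P (fun (n : ℕ) ω => (1 + δ) / ((n * p n) * √(n * p n)) *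
      ((excSum n (fun i => V n i ω) fun v => v ^ δ - 1 / (1 + δ)) ^ 2
        + ((excSum n (fun i => V n i ω) fun _ => 1) - n * p n) ^ 2)) atTop fun _ => 0 := by
    refine tendstoInMeasure_zero_of_integral_le (b := fun n => 2 * (1 + δ) * (√(n * p n))⁻¹)
      (g := fun (n : ℕ) ω => (1 + δ) / ((n * p n) * √(n * p n)) *
        ((excSum n (fun i => V n i ω) fun v => v ^ δ - 1 / (1 + δ)) ^ 2
          + ((excSum n (fun i => V n i ω) fun _ => 1) - n * p n) ^ 2))
      ?_ (Eventually.of_forall fun n => ((i2 n).add (i1 n)).const_mul _) ?_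
      (by simpa using h.tendsto_inv_sqrt.const_mul (2 * (1 + δ)))
    · refine Eventually.of_forall fun n => ae_of_all _ fun ω => (abs_of_nonneg ?_).le
      have := (h.pos n).le
      positivity
    · filter_upwards [b1, b2, hN] with n h1 h2 h3
      rw [integral_const_mul, integral_add (i2 n) (i1 n)]
      calc _ ≤ (1 + δ) / ((n * p n) * √(n * p n)) * (n * p n + n * p n) := by
            gcongr
        _ = _ := by
            generalize (n : ℝ) * p n = N at h3
            have := Real.sqrt_pos.2 h3
            field_simp
            ring
  refine tendstoInMeasure_zero_of_le hE hg ?_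
  filter_upwards [hN] with n h3
  refine ae_of_all _ fun ω hω => ?_
  simp only [not_le] at hω
  set t := excSum n (fun i => V n i ω) fun _ => 1
  set S := excSum n (fun i => V n i ω) fun v => v ^ δ - 1 / (1 + δ)
  set N : ℝ := n * p n
  have h4 : |t - N| ≤ N / 2 := by
    rw [inv_pow, inv_mul_lt_iff₀ (by positivity)] at hω
    refine abs_le_of_sq_le_sq ?_ (by positivity)
    nlinarith
  have h5 := abs_inv_sqrt_sub_inv_sqrt_le h3 h4
  have e : (1 + δ) / √t * S - (√N)⁻¹ * (1 + δ) * S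
      = -((1 + δ) * S * ((√N)⁻¹ - (√t)⁻¹)) := by
    rw [div_eq_mul_inv]; ring
  have hs := Real.sqrt_pos.2 h3
  rw [e, abs_neg, abs_mul, abs_mul, abs_of_pos (by linarith : 0 < 1 + δ)]
  refine le_trans ?_ (le_abs_self _)
  calc _ ≤ (1 + δ) * |S| * (2 * |t - N| / (N * √N)) := by gcongr
    _ = (1 + δ) / (N * √N) * (2 * |S| * |t - N|) := by ring
    _ ≤ (1 + δ) / (N * √N) * (S ^ 2 + (t - N) ^ 2) := by
        gcongr
        rw [← sq_abs S, ← sq_abs (t - N)]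
        exact two_mul_le_add_sq _ _

end Array

end GPPTest

/-! ### Gaussian limits, and transfer from the model to arrays -/

namespace GPPTest

theorem map_prod_gaussianReal (K κ : ℝ) (v : NNReal) :
    ((gaussianReal 0 1).prod (gaussianReal 0 v)).map (fun z => K * (z.1 + z.2) - κ)
      = gaussianReal (-κ) (K ^ 2 * (1 + v)).toNNReal := by
  have h1 : ((gaussianReal 0 1).prod (gaussianReal 0 v)).map (fun z => z.1 + z.2)
      = gaussianReal 0 (1 + v) := by
    have := gaussianReal_conv_gaussianReal (m₁ := 0) (m₂ := 0) (v₁ := 1) (v₂ := v)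
    rw [add_zero] at this
    exact this
  have h2 : (fun z : ℝ × ℝ => K * (z.1 + z.2) - κ)
      = (fun x => x - κ) ∘ (fun x => K * x) ∘ fun z : ℝ × ℝ => z.1 + z.2 := rfl
  rw [h2, ← Measure.map_map (by fun_prop) (by fun_prop),
    ← Measure.map_map (by fun_prop) (by fun_prop), h1, gaussianReal_map_const_mul,
    gaussianReal_map_sub_const, mul_zero, zero_sub]
  congr 1
  apply NNReal.eq
  rw [Real.coe_toNNReal _ (by positivity)]
  push_cast
  rfl

theorem tendstoInDistribution_congr_limit {Ω E Ω₁ Ω₂ : Type*} [MeasurableSpace Ω]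
    [MeasurableSpace Ω₁] [MeasurableSpace Ω₂] [TopologicalSpace E] [MeasurableSpace E]
    [OpensMeasurableSpace E] {P : Measure Ω} [IsProbabilityMeasure P] {μ₁ : Measure Ω₁}
    [IsProbabilityMeasure μ₁] {μ₂ : Measure Ω₂} [IsProbabilityMeasure μ₂] {X : ℕ → Ω → E}
    {Y₁ : Ω₁ → E} {Y₂ : Ω₂ → E} (h : TendstoInDistribution X atTop Y₁ (fun _ => P) μ₁)
    (hY : AEMeasurable Y₂ μ₂) (heq : μ₁.map Y₁ = μ₂.map Y₂) :
    TendstoInDistribution X atTop Y₂ (fun _ => P) μ₂ := by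
  refine ⟨h.forall_aemeasurable, hY, ?_⟩
  have := h.tendsto
  simp only [heq] at this
  exact this

/-- Takes the infimum of the admissible positive bounds; adding `1 / (n + 1)` ensures that the
chosen value exceeds some admissible one. -/
theorem exists_tendsto_zero {p : ℕ → ℝ → Prop} (hmono : ∀ n a b, a ≤ b → p n a → p n b)
    (h : ∀ ε > 0, ∀ᶠ n in atTop, p n ε) :
    ∃ e : ℕ → ℝ, Tendsto e atTop (𝓝 0) ∧ ∀ᶠ n in atTop, p n (e n) := by
  have hnn : ∀ n, 0 ≤ sInf {a | 0 < a ∧ p n a} := fun n => Real.sInf_nonneg fun a ha => ha.1.le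
  refine ⟨fun n => sInf {a | 0 < a ∧ p n a} + 1 / ((n : ℝ) + 1), ?_, ?_⟩
  · have h1 : Tendsto (fun n => sInf {a | 0 < a ∧ p n a}) atTop (𝓝 0) := by
      rw [Metric.tendsto_nhds]
      intro ε hε
      filter_upwards [h (ε / 2) (half_pos hε)] with n hn
      rw [Real.dist_eq, sub_zero, abs_of_nonneg (hnn n)]
      have h1 : sInf {a | 0 < a ∧ p n a} ≤ ε / 2 :=
        csInf_le ⟨0, fun a ha => ha.1.le⟩ ⟨half_pos hε, hn⟩
      exact h1.trans_lt (half_lt_self hε)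
    simpa using h1.add tendsto_one_div_add_atTop_nhds_zero_nat
  · filter_upwards [h 1 one_pos] with n hn
    obtain ⟨a, ha, hlt⟩ := exists_lt_of_csInf_lt (s := {a | 0 < a ∧ p n a}) ⟨1, one_pos, hn⟩
      (lt_add_of_pos_right _ (by positivity : (0:ℝ) < 1 / ((n : ℝ) + 1)))
    exact hmono n _ _ hlt.le ha.2

/-- With `X = ∫ x`, the mass left outside is `1 - p (1 + X) = (1 - p) (1 - p / (1 - p) * X)`; the
size conditions keep the last factor positive. -/
theorem restrict_eq_withDensity_and_compl {ν₀ ν₁ : Measure ℝ} [IsProbabilityMeasure ν₀]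
    [IsProbabilityMeasure ν₁] {p : ℝ} {x : ℝ → ℝ} (hp : 0 < p) (hp2 : p ≤ 1 / 2)
    (hx : Measurable x) (hx2 : ∀ v ∈ Icc (0:ℝ) 1, |x v| ≤ 1 / 2)
    (h₀ : ν₀.restrict (Icc 0 1) = ENNReal.ofReal p • (volume : Measure ℝ).restrict (Icc 0 1))
    (h₁ : ν₁.restrict (Icc 0 1) = ((volume : Measure ℝ).restrict (Icc 0 1)).withDensity
      fun v => ENNReal.ofReal (p * (1 + x v))) :
    ν₁.restrict (Icc 0 1)
        = (ν₀.restrict (Icc 0 1)).withDensity (fun v => ENNReal.ofReal (1 + x v)) ∧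
      ν₁ (Icc 0 1)ᶜ = ENNReal.ofReal
        (Real.exp (Real.log (1 - p / (1 - p) * ∫ v in Icc 0 1, x v))) * ν₀ (Icc 0 1)ᶜ := by
  have hX := abs_le.1 (setIntegral_Icc_le hx2)
  have hix : IntegrableOn x (Icc 0 1) :=
    Measure.integrableOn_of_bounded (by simp) hx.aestronglyMeasurable
      ((ae_restrict_iff' measurableSet_Icc).2 (ae_of_all _ hx2))
  have m1 : Measurable fun v => ENNReal.ofReal (1 + x v) := by fun_prop
  constructor
  · rw [h₁, h₀, withDensity_smul_measure, ← withDensity_smul _ m1]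
    congr 1
    funext v
    rw [Pi.smul_apply, smul_eq_mul, ENNReal.ofReal_mul hp.le]
  · set X := ∫ v in Icc 0 1, x v with hXdef
    have e0 : ν₀ (Icc 0 1) = ENNReal.ofReal p := by
      rw [← Measure.restrict_apply_self, h₀]
      simp
    have e1 : ν₁ (Icc 0 1) = ENNReal.ofReal (p * (1 + X)) := by
      rw [← Measure.restrict_apply_self, h₁, withDensity_apply _ measurableSet_Icc,
        Measure.restrict_restrict measurableSet_Icc, inter_self,
        ← ofReal_integral_eq_lintegral_ofReal]
      · rw [integral_const_mul, integral_add (by simp) hix]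
        simp [X]
      · exact ((integrable_const _).add hix).const_mul _
      · refine (ae_restrict_iff' measurableSet_Icc).2 (ae_of_all _ fun v hv => ?_)
        have := abs_le.1 (hx2 v hv)
        exact mul_nonneg hp.le (by linarith)
    have hq : 0 < 1 - p / (1 - p) * X := by
      have : p / (1 - p) ≤ 1 := (div_le_one (by linarith)).2 (by linarith)
      have h0 : 0 < p / (1 - p) := div_pos hp (by linarith)
      nlinarith
    rw [prob_compl_eq_one_sub measurableSet_Icc, prob_compl_eq_one_sub measurableSet_Icc, e0, e1,
      Real.exp_log hq, ← ENNReal.ofReal_one, ← ENNReal.ofReal_sub _ hp.le,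
      ← ENNReal.ofReal_sub _ (mul_nonneg hp.le (by linarith)), ← ENNReal.ofReal_mul hq.le]
    congr 1
    have : 1 - p ≠ 0 := by linarith
    field_simp
    ring

variable {Ω : Type*}

/-- The list keeps the values `≤ 1` and `excSum` those in `[0,1]`; nonnegativity makes the two
selections agree. -/
theorem sum_map_exceedances {M : ℝ} {W : ℕ → Ω → ℝ} {Z : ℕ → Ω → C(unitInterval, ℝ)} {n : ℕ}
    {c : ℝ} {ω : Ω} {v : ℕ → ℝ} (hv : ∀ i, supX M c (W i ω) (Z i ω) = v i) (hv0 : ∀ i, 0 ≤ v i)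
    (φ : ℝ → ℝ) : ((exceedances M W Z n c ω).map φ).sum = excSum n v φ := by
  simp only [exceedances, hv, excSum]
  induction n with
  | zero => simp
  | succ k ih =>
    rw [List.range_succ, List.map_append, List.filter_append, List.map_append, List.sum_append, ih,
      Finset.sum_range_succ]
    congr 1
    by_cases h : v k ≤ 1
    · simp [h, hv0 k]
    · simp [h]

theorem numExc_eq {M : ℝ} {W : ℕ → Ω → ℝ} {Z : ℕ → Ω → C(unitInterval, ℝ)} {n : ℕ}
    {c : ℝ} {ω : Ω} {v : ℕ → ℝ} (hv : ∀ i, supX M c (W i ω) (Z i ω) = v i) (hv0 : ∀ i, 0 ≤ v i) :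
    (numExc M W Z n c ω : ℝ) = excSum n v fun _ => 1 := by
  rw [← sum_map_exceedances hv hv0]
  simp [numExc]

variable [MeasurableSpace Ω]

section Model

variable {δ M : ℝ} {Θ : Set ℝ} {H : ℝ → Measure ℝ} {Q : Measure C(unitInterval, ℝ)}
  {P : ℝ → Measure Ω} {W : ℕ → Ω → ℝ} {Z : ℕ → Ω → C(unitInterval, ℝ)}

theorem IsSample.measurable_obs (hS : IsSample Θ H Q P W Z) (M c : ℝ) (i : ℕ) :
    Measurable fun ω => obs M c (W i ω, Z i ω) :=
  (GPPTest.measurable_obs M c).comp ((hS.measurable_W i).prodMk (hS.measurable_Z i))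

theorem IsSample.iIndepFun_obs (hS : IsSample Θ H Q P W Z) (M c : ℝ) {ϑ : ℝ} (hϑ : ϑ ∈ Θ) :
    ProbabilityTheory.iIndepFun (fun i ω => obs M c (W i ω, Z i ω)) (P ϑ) :=
  (hS.iIndepFun ϑ hϑ).comp (fun _ => obs M c) fun _ => GPPTest.measurable_obs M c

theorem IsSample.supX_ae_eq (hS : IsSample Θ H Q P W Z) (hQ : IsGeneratorLaw Q)
    (hH : IsDeltaFamily δ Θ H) (hM : M < 0) {c : ℝ} (hc : c < 0) {ϑ : ℝ} (hϑ : ϑ ∈ Θ) :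
    ∀ᵐ ω ∂P ϑ, ∀ i, supX M c (W i ω) (Z i ω) = obs M c (W i ω, Z i ω) := by
  rw [ae_all_iff]
  intro i
  obtain ⟨m, -, hm⟩ := hQ.bounded
  rw [← hS.law_Z ϑ hϑ i] at hm
  have h1 := ae_of_ae_map (hS.measurable_Z i).aemeasurable hm
  have h2 : ∀ᵐ w ∂(P ϑ).map (W i), 0 ≤ w := by
    rw [hS.law_W ϑ hϑ i, ae_iff]
    simp only [not_le]
    exact hH.nonneg ϑ hϑ
  filter_upwards [h1, ae_of_ae_map (hS.measurable_W i).aemeasurable h2] with ω hz hw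
  exact supX_eq_obs hM hc hw fun t => (hz t).1

theorem IsSample.pointProcess_ae_eq (hS : IsSample Θ H Q P W Z) (hQ : IsGeneratorLaw Q)
    (hH : IsDeltaFamily δ Θ H) (hM : M < 0) {c : ℝ} (hc : c < 0) {ϑ : ℝ} (hϑ : ϑ ∈ Θ) (n : ℕ) :
    pointProcess M W Z n c =ᵐ[P ϑ] fun ω => pointMeasure n fun i => obs M c (W i ω, Z i ω) := by
  filter_upwards [hS.supX_ae_eq hQ hH hM hc hϑ] with ω hω
  simp only [pointProcess, pointMeasure, hω]

theorem IsSample.pointProcessLaw_eq (hS : IsSample Θ H Q P W Z) (hQ : IsGeneratorLaw Q)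
    (hH : IsDeltaFamily δ Θ H) (hM : M < 0) {c : ℝ} (hc : c < 0) {ϑ : ℝ} (hϑ : ϑ ∈ Θ) (n : ℕ) :
    pointProcessLaw (P ϑ) M W Z n c
      = (P ϑ).map fun ω => pointMeasure n fun i => obs M c (W i ω, Z i ω) :=
  Measure.map_congr (hS.pointProcess_ae_eq hQ hH hM hc hϑ n)

variable [∀ ϑ, IsProbabilityMeasure (P ϑ)]

theorem IsSample.map_obs (hS : IsSample Θ H Q P W Z) (M c : ℝ) {ϑ : ℝ} (hϑ : ϑ ∈ Θ) (i : ℕ) :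
    (P ϑ).map (fun ω => obs M c (W i ω, Z i ω)) = ((H ϑ).prod Q).map (obs M c) := by
  have h := (indepFun_iff_map_prod_eq_prod_map_map (hS.measurable_W i).aemeasurable
    (hS.measurable_Z i).aemeasurable).1 (hS.indepFun ϑ hϑ i)
  rw [hS.law_W ϑ hϑ, hS.law_Z ϑ hϑ] at h
  rw [← h, Measure.map_map (GPPTest.measurable_obs M c)
    ((hS.measurable_W i).prodMk (hS.measurable_Z i))]
  rfl

/-- Absolute continuity of the laws of the point processes, and the log likelihood ratio. -/
theorem IsSample.absolutelyContinuous_and_logLR (hS : IsSample Θ H Q P W Z)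
    (hQ : IsGeneratorLaw Q) (hH : IsDeltaFamily δ Θ H) (hM : M < 0) {c : ℝ} (hc : c < 0) {ϑ : ℝ}
    (hϑ : ϑ ∈ Θ) (n : ℕ) {p : ℝ} {x : ℝ → ℝ} (hp : 0 < p) (hp2 : p ≤ 1 / 2)
    (hx : Measurable x) (hx2 : ∀ v ∈ Icc (0:ℝ) 1, |x v| ≤ 1 / 2)
    (h₀ : (((H 0).prod Q).map (obs M c)).restrict (Icc 0 1)
      = ENNReal.ofReal p • (volume : Measure ℝ).restrict (Icc 0 1))
    (h₁ : (((H ϑ).prod Q).map (obs M c)).restrict (Icc 0 1)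
      = ((volume : Measure ℝ).restrict (Icc 0 1)).withDensity
        fun v => ENNReal.ofReal (p * (1 + x v))) :
    pointProcessLaw (P ϑ) M W Z n c ≪ pointProcessLaw (P 0) M W Z n c ∧
      ∀ᵐ ω ∂P 0, logLR P M W Z n c ϑ ω = ∑ i ∈ Finset.range n,
        logDens (Real.log (1 - p / (1 - p) * ∫ v in Icc 0 1, x v)) x (obs M c (W i ω, Z i ω)) := by
  have := hQ.isProbabilityMeasure
  have := hH.isProbabilityMeasure 0 hH.zero_mem
  have := hH.isProbabilityMeasure ϑ hϑ
  have mo := GPPTest.measurable_obs M c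
  have : IsProbabilityMeasure (((H 0).prod Q).map (obs M c)) :=
    Measure.isProbabilityMeasure_map mo.aemeasurable
  have : IsProbabilityMeasure (((H ϑ).prod Q).map (obs M c)) :=
    Measure.isProbabilityMeasure_map mo.aemeasurable
  obtain ⟨hin, hout⟩ := restrict_eq_withDensity_and_compl hp hp2 hx hx2 h₀ h₁
  have key := map_pointMeasure_eq_withDensity (hS.measurable_obs M c)
    (hS.iIndepFun_obs M c hH.zero_mem) (hS.iIndepFun_obs M c hϑ) (hS.map_obs M c hH.zero_mem)
    (hS.map_obs M c hϑ) hx (fun v hv => by linarith [(abs_le.1 (hx2 v hv)).1]) hin hout n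
  constructor
  · rw [hS.pointProcessLaw_eq hQ hH hM hc hϑ, hS.pointProcessLaw_eq hQ hH hM hc hH.zero_mem, key]
    exact withDensity_absolutelyContinuous _ _
  · filter_upwards [llr_map_pointMeasure (hS.measurable_obs M c) hx key,
      hS.pointProcess_ae_eq hQ hH hM hc hH.zero_mem n] with ω h1 h2
    rw [logLR, hS.pointProcessLaw_eq hQ hH hM hc hϑ,
      hS.pointProcessLaw_eq hQ hH hM hc hH.zero_mem, h2, h1]

end Model

end GPPTest

/-! ### The limit theorem -/

theorem GPPTest.sqrt_mul_rpow {n : ℕ} {a δ : ℝ} (ha : 0 < a) :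
    √(n * a ^ (1 + 2 * δ)) = √(n * a) * a ^ δ := by
  have h1 : n * a ^ (1 + 2 * δ) = n * a * (a ^ δ) ^ 2 := by
    rw [Real.rpow_add ha, Real.rpow_one, ← Real.rpow_natCast, ← Real.rpow_mul ha.le,
      mul_comm δ, Nat.cast_ofNat]
    ring
  rw [h1, Real.sqrt_mul (by positivity), Real.sqrt_sq (Real.rpow_nonneg ha.le _)]

theorem GPPTest.restrict_eq_withDensity_of_subset {μ : Measure ℝ} {f : ℝ → ENNReal} {s t : Set ℝ}
    (hs : MeasurableSet s) (hst : s ⊆ t)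
    (h : μ.restrict t = ((volume : Measure ℝ).restrict t).withDensity f) :
    μ.restrict s = ((volume : Measure ℝ).restrict s).withDensity f := by
  rw [← inter_eq_left.2 hst, ← Measure.restrict_restrict hs, h, restrict_withDensity hs,
    Measure.restrict_restrict hs]

theorem theorem2p2 {Ω : Type*} [MeasurableSpace Ω] {δ M ξ : ℝ} {Θ : Set ℝ}
    {H : ℝ → Measure ℝ} {Q : Measure C(unitInterval, ℝ)}
    (hM : M < 0) (hQ : GPPTest.IsGeneratorLaw Q) (hA : 0 < GPPTest.constA Q)
    (hH : GPPTest.IsDeltaFamily δ Θ H)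
    {P : ℝ → Measure Ω} [∀ ϑ, IsProbabilityMeasure (P ϑ)]
    {W : ℕ → Ω → ℝ} {Z : ℕ → Ω → C(unitInterval, ℝ)}
    (hS : GPPTest.IsSample Θ H Q P W Z)
    {c : ℕ → ℝ} (hcneg : ∀ n, c n < 0) (hc : Tendsto c atTop (𝓝 0))
    (hnc : Tendsto (fun n : ℕ => (n : ℝ) * |c n| ^ (1 + 2 * δ)) atTop atTop) :
    -- eventually the law of the point process under `ϑ_n` is dominated by the one under `0`
    (∀ᶠ n in atTop,
      GPPTest.altSeq δ ξ c n ∈ Θ ∧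
      GPPTest.pointProcessLaw (P (GPPTest.altSeq δ ξ c n)) M W Z n (c n) ≪
        GPPTest.pointProcessLaw (P 0) M W Z n (c n)) ∧
    -- the expansion of the log-likelihood ratio, up to `o_{P_0}(1)`
    TendstoInMeasure (P 0)
      (fun n ω => GPPTest.logLR P M W Z n (c n) (GPPTest.altSeq δ ξ c n) ω -
        (ξ * GPPTest.constB Q δ / ((1 + δ) * √(GPPTest.constA Q)) *
            (GPPTest.statZ1 Q M W Z n (c n) ω + GPPTest.statZ2 δ M W Z n (c n) ω) -
          ξ ^ 2 * GPPTest.constB Q δ ^ 2 / (2 * GPPTest.constA Q * (2 * δ + 1))))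
      atTop (fun _ => 0) ∧
    -- its asymptotic normality under `0`
    TendstoInDistribution
      (fun n => GPPTest.logLR P M W Z n (c n) (GPPTest.altSeq δ ξ c n)) atTop id
      (fun _ => P 0)
      (gaussianReal (-(ξ ^ 2 * GPPTest.constB Q δ ^ 2 / (2 * GPPTest.constA Q * (2 * δ + 1))))
        (ξ ^ 2 * GPPTest.constB Q δ ^ 2 / (GPPTest.constA Q * (2 * δ + 1))).toNNReal) ∧
    -- the marginal limits of the two statistics under `0`
    TendstoInDistribution (fun n => GPPTest.statZ1 Q M W Z n (c n)) atTop id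
      (fun _ => P 0) (gaussianReal 0 1) ∧
    TendstoInDistribution (fun n => GPPTest.statZ2 δ M W Z n (c n)) atTop id
      (fun _ => P 0) (gaussianReal 0 (δ ^ 2 / (2 * δ + 1)).toNNReal) ∧
    -- their asymptotic independence: the joint limit is the product of the marginal limits
    TendstoInDistribution
      (fun n ω => (GPPTest.statZ1 Q M W Z n (c n) ω, GPPTest.statZ2 δ M W Z n (c n) ω)) atTop id
      (fun _ => P 0)
      ((gaussianReal 0 1).prod (gaussianReal 0 (δ ^ 2 / (2 * δ + 1)).toNNReal)) := by
  open GPPTest in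
  have hδ := hH.delta_pos
  have h0 := hH.zero_mem
  have hQp := hQ.isProbabilityMeasure
  obtain ⟨m, -, hm⟩ := hQ.bounded
  obtain ⟨h, u₀, ε₀, hu₀, hε₀, hd, hr⟩ := hH.exists_density
  have hc0 : ∀ n, 0 < |c n| := fun n => abs_pos.2 (hcneg n).ne
  have hcabs : Tendsto (fun n => |c n|) atTop (𝓝 0) := by simpa using hc.abs
  have hB := constB_nonneg hδ hm
  set A := constA Q with hAdef
  set B := constB Q δ with hBdef
  set V : ℕ → ℕ → Ω → ℝ := fun n i ω => obs M (c n) (W i ω, Z i ω) with hV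
  have hcM : ∀ᶠ n in atTop, |c n| < |M| := hcabs.eventually_lt_const (abs_pos.2 hM.ne)
  have hcm : ∀ u > 0, ∀ᶠ n in atTop, |c n| * m ≤ u := fun u hu => by
    have h1 : Tendsto (fun n => |c n| * m) atTop (𝓝 0) := by simpa using hcabs.mul_const m
    exact h1.eventually_le_const hu
  have hncA : Tendsto (fun n : ℕ => (n : ℝ) * |c n|) atTop atTop := by
    refine tendsto_atTop_mono' _ ?_ hnc
    filter_upwards [hcabs.eventually_le_const one_pos] with n hn
    refine mul_le_mul_of_nonneg_left ?_ (Nat.cast_nonneg n)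
    calc |c n| ^ (1 + 2 * δ) ≤ |c n| ^ (1:ℝ) :=
          Real.rpow_le_rpow_of_exponent_ge (hc0 n) hn (by linarith)
      _ = _ := Real.rpow_one _
  -- the alternatives
  set t : ℕ → ℝ := altSeq δ ξ c with ht
  have ht0 : Tendsto t atTop (𝓝 0) :=
    (Real.tendsto_sqrt_atTop.comp hnc).const_div_atTop ξ
  have htΘ : ∀ᶠ n in atTop, t n ∈ Θ := ht0.eventually (hH.isOpen.mem_nhds h0)
  have htε : ∀ᶠ n in atTop, |t n| ≤ ε₀ := by
    have : Tendsto (fun n => |t n|) atTop (𝓝 0) := by simpa using ht0.abs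
    exact this.eventually_le_const hε₀
  -- density bounds at scale `c n`
  have hprob : ∀ ϑ ∈ Θ, IsProbabilityMeasure (H ϑ) := hH.isProbabilityMeasure
  have hH0 := hprob 0 h0
  have harr : IsUniformArray (P 0) V (fun n => ((H 0).prod Q).map (obs M (c n)))
      (fun n => |c n| * A) := by
    refine ⟨fun n i => hS.measurable_obs M (c n) i, fun n => hS.iIndepFun_obs M (c n) h0,
      fun n i => hS.map_obs M (c n) h0 i, fun n => mul_pos (hc0 n) hA, ?_, ?_, ?_⟩
    · simpa using hcabs.mul_const A
    · simpa only [mul_assoc] using hncA.atTop_mul_const hA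
    · obtain ⟨u₁, hu₁, hle, hr1⟩ := hr 1 one_pos
      filter_upwards [hcM, hcm u₁ hu₁] with n h1 h2
      obtain ⟨d1, d2, d3⟩ := hd 0 h0
      have hr2 := hr1 0 h0 (by simpa using hε₀.le)
      have h3 := restrict_map_obs hδ hA hm (hH.nonneg 0 h0) d1
        (fun u hu => d2 u ⟨hu.1, hu.2.trans hle⟩)
        (restrict_eq_withDensity_of_subset measurableSet_Icc (Icc_subset_Icc_right hle) d3)
        hr2 zero_le_one h2 h1 (hc0 n)
      rw [h3, ← withDensity_const]
      refine withDensity_congr_ae ((ae_restrict_iff' measurableSet_Icc).2 (ae_of_all _ fun v hv => ?_))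
      -- At `ϑ = 0` both the leading term and the error bound are zero, so the observation is
      -- exactly uniform on `[0,1]`.
      have h4 := abs_relDens_sub_le hδ hA hm d1 hr2 zero_le_one h2 hv
      simp only [zero_mul, mul_zero, sub_zero, abs_zero] at h4
      beta_reduce
      rw [abs_nonpos_iff.1 h4, add_zero, mul_one]
  set η : ℕ → ℝ := fun n => t n * |c n| ^ δ with hη
  set b : ℝ := B / A with hb
  have hb0 : 0 ≤ b := div_nonneg hB hA.le
  classical
  -- For finitely many `n` the alternative may lie outside `Θ`; the value `0` keeps `x n` measurable
  -- for every `n`.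
  set x : ℕ → ℝ → ℝ := fun n => if t n ∈ Θ then relDens Q (h (t n)) (c n) else fun _ => 0 with hx
  have hxm : ∀ n, Measurable (x n) := fun n => by
    simp only [hx]
    split_ifs with h1
    exacts [measurable_relDens (hd _ h1).1 _, measurable_const]
  have hxe : ∀ ε > 0, ∀ᶠ n in atTop, ∀ v ∈ Icc (0:ℝ) 1, |x n v - η n * b * v ^ δ| ≤ ε * |η n| := by
    intro ε hε
    obtain ⟨u₁, hu₁, hle, hr1⟩ := hr (ε / (b + 1)) (by positivity)
    filter_upwards [htΘ, htε, hcm u₁ hu₁] with n h1 h2 h3 v hv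
    have h4 := abs_relDens_sub_le hδ hA hm (hd _ h1).1 (hr1 _ h1 h2) (by positivity) h3 hv
    simp only [hx, if_pos h1]
    refine h4.trans ?_
    calc ε / (b + 1) * |η n| * b ≤ ε / (b + 1) * |η n| * (b + 1) := by gcongr; linarith
      _ = _ := by field_simp
  obtain ⟨e, he0, hxe'⟩ := exists_tendsto_zero (p := fun n a => ∀ v ∈ Icc (0:ℝ) 1,
    |x n v - η n * b * v ^ δ| ≤ a * |η n|) (fun n a a' haa h1 v hv =>
      (h1 v hv).trans (mul_le_mul_of_nonneg_right haa (abs_nonneg _))) hxe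
  -- The rate of `ϑ_n` is chosen for this: the powers of `|c|` cancel and `ϑ_n |c|^δ = ξ / √(n
  -- |c|)`.
  have hηsqrt : ∀ᶠ n : ℕ in atTop, η n * √(n * (|c n| * A)) = ξ * √A := by
    filter_upwards [hncA.eventually_gt_atTop 0] with n hn
    have h1 := Real.sqrt_pos.2 hn
    have h2 := Real.rpow_pos_of_pos (hc0 n) δ
    simp only [hη, ht, altSeq]
    rw [sqrt_mul_rpow (hc0 n), ← mul_assoc, Real.sqrt_mul hn.le]
    field_simp
  have hκ : ∀ᶠ n : ℕ in atTop, η n ^ 2 * (n * (|c n| * A)) = ξ ^ 2 * A := by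
    filter_upwards [hηsqrt] with n hn
    have h1 : (0:ℝ) ≤ n * (|c n| * A) := by have := hc0 n; positivity
    rw [← Real.sq_sqrt h1, ← mul_pow, hn, mul_pow, Real.sq_sqrt hA.le]
  set l : ℕ → ℝ := fun n =>
    Real.log (1 - |c n| * A / (1 - |c n| * A) * ∫ v in Icc 0 1, x n v) with hl
  have hexp := harr.tendstoInMeasure_logDens hδ hb0 hκ he0 hxm hxe'
    (Eventually.of_forall fun n => (rfl : l n = _))
  have hη0 : Tendsto (fun n => |η n|) atTop (𝓝 0) := by
    have h1 : Tendsto (fun n => |c n| ^ δ) atTop (𝓝 0) := by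
      simpa [Real.zero_rpow hδ.ne'] using hcabs.rpow_const (p := δ) (Or.inr hδ.le)
    have h2 := (ht0.mul h1).abs
    rwa [zero_mul, abs_zero] at h2
  have hdom : ∀ᶠ n in atTop, t n ∈ Θ ∧
      pointProcessLaw (P (t n)) M W Z n (c n) ≪ pointProcessLaw (P 0) M W Z n (c n) ∧
      ∀ᵐ ω ∂P 0, logLR P M W Z n (c n) (t n) ω
        = ∑ i ∈ Finset.range n, logDens (l n) (x n) (V n i ω) := by
    obtain ⟨u₁, hu₁, hle, hr1⟩ := hr 1 one_pos
    have hsmall : Tendsto (fun n => (1 + b) * |η n|) atTop (𝓝 0) := by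
      simpa using hη0.const_mul (1 + b)
    filter_upwards [htΘ, htε, hcM, hcm u₁ hu₁, hxe 1 one_pos, harr.restrict,
      harr.tendsto_zero.eventually_le_const (by norm_num : (0:ℝ) < 1 / 2),
      hsmall.eventually_le_const (by norm_num : (0:ℝ) < 1 / 2)] with n h1 h2 h3 h4 h5 h6 h7 h8
    obtain ⟨d1, d2, d3⟩ := hd _ h1
    have := hprob _ h1
    have h9 := restrict_map_obs hδ hA hm (hH.nonneg _ h1) d1
      (fun u hu => d2 u ⟨hu.1, hu.2.trans hle⟩)
      (restrict_eq_withDensity_of_subset measurableSet_Icc (Icc_subset_Icc_right hle) d3)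
      (hr1 _ h1 h2) zero_le_one h4 h3 (hc0 n)
    have hxn : relDens Q (h (t n)) (c n) = x n := by simp only [hx, if_pos h1]
    rw [hxn] at h9
    refine ⟨h1, hS.absolutelyContinuous_and_logLR hQ hH hM (hcneg n) h1 n (harr.pos n) h7 (hxm n)
      (fun v hv => ?_) h6 h9⟩
    have h10 := Real.rpow_nonneg hv.1 δ
    have h11 := Real.rpow_le_one hv.1 hv.2 hδ.le
    calc |x n v| = |(x n v - η n * b * v ^ δ) + η n * b * v ^ δ| := by ring_nf
      _ ≤ |x n v - η n * b * v ^ δ| + |η n * b * v ^ δ| := abs_add_le _ _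
      _ ≤ 1 * |η n| + |η n| * b * 1 := by
          rw [abs_mul, abs_mul, abs_of_nonneg hb0, abs_of_nonneg h10]
          exact add_le_add (h5 v hv) (by gcongr)
      _ ≤ 1 / 2 := by linarith
  -- the statistics in terms of the array
  have hsup : ∀ n, ∀ᵐ ω ∂P 0, ∀ i, supX M (c n) (W i ω) (Z i ω) = V n i ω := fun n =>
    hS.supX_ae_eq hQ hH hM (hcneg n) h0
  have hVnn : ∀ n i ω, 0 ≤ V n i ω := fun n i ω => obs_nonneg _ _ _
  set Y₁ : ℕ → Ω → ℝ := fun n ω => (√(n * (|c n| * A)))⁻¹ *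
    ((excSum n (fun i => V n i ω) fun _ => 1) - n * (|c n| * A)) with hY₁
  set Y₂ : ℕ → Ω → ℝ := fun n ω => (√(n * (|c n| * A)))⁻¹ * (1 + δ) *
    excSum n (fun i => V n i ω) fun v => v ^ δ - 1 / (1 + δ) with hY₂
  have hZ1 : ∀ n, statZ1 Q M W Z n (c n) =ᵐ[P 0] Y₁ n := fun n => by
    filter_upwards [hsup n] with ω hω
    simp only [statZ1, hY₁]
    rw [numExc_eq hω fun i => hVnn n i ω, div_eq_inv_mul, mul_assoc (n : ℝ)]
  have hZ2 : ∀ n, statZ2 δ M W Z n (c n) =ᵐ[P 0] fun ω =>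
      (1 + δ) / √(excSum n (fun i => V n i ω) fun _ => 1)
        * (excSum n (fun i => V n i ω) fun v => v ^ δ - 1 / (1 + δ)) := fun n => by
    filter_upwards [hsup n] with ω hω
    simp only [statZ2]
    rw [numExc_eq hω fun i => hVnn n i ω, sum_map_exceedances hω fun i => hVnn n i ω]
  have hren : TendstoInMeasure (P 0) (fun n ω => statZ2 δ M W Z n (c n) ω - Y₂ n ω) atTop
      fun _ => 0 := by
    refine (harr.tendstoInMeasure_renormalize hδ).congr_left fun n => ?_
    filter_upwards [hZ2 n] with ω hω
    rw [hω]
  have mZ1 : ∀ n, AEMeasurable (statZ1 Q M W Z n (c n)) (P 0) := fun n => by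
    refine AEMeasurable.congr (Measurable.aemeasurable ?_) (hZ1 n).symm
    exact ((measurable_excSum (harr.measurable n) measurable_const n).sub_const _).const_mul _
  have mG : Measurable fun v : ℝ => v ^ δ - 1 / (1 + δ) := (measurable_id.pow_const δ).sub_const _
  have mZ2 : ∀ n, AEMeasurable (statZ2 δ M W Z n (c n)) (P 0) := fun n => by
    refine AEMeasurable.congr (Measurable.aemeasurable ?_) (hZ2 n).symm
    have h1 := measurable_excSum (harr.measurable n) (measurable_const (a := (1:ℝ))) n
    have h2 := measurable_excSum (harr.measurable n) mG n
    fun_prop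
  have hjoint : TendstoInDistribution
      (fun n ω => (statZ1 Q M W Z n (c n) ω, statZ2 δ M W Z n (c n) ω)) atTop id
      (fun _ => P 0)
      ((gaussianReal 0 1).prod (gaussianReal 0 (δ ^ 2 / (2 * δ + 1)).toNNReal)) := by
    refine tendstoInDistribution_of_tendstoInMeasure_sub _ _
      (harr.tendstoInDistribution_pair hδ) ?_ fun n => (mZ1 n).prodMk (mZ2 n)
    rw [tendstoInMeasure_iff_norm] at hren ⊢
    intro ε hε
    refine (hren ε hε).congr fun n => measure_congr ?_
    -- The first coordinates agree almost surely, so the norm of the difference of the pairs is that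
    -- of the second coordinates.
    filter_upwards [hZ1 n] with ω hω
    have e1 : statZ1 Q M W Z n (c n) ω - Y₁ n ω = 0 := sub_eq_zero.2 hω
    refine propext ?_
    change ε ≤ ‖statZ2 δ M W Z n (c n) ω - Y₂ n ω - 0‖ ↔
      ε ≤ ‖(statZ1 Q M W Z n (c n) ω - Y₁ n ω, statZ2 δ M W Z n (c n) ω - Y₂ n ω)
        - (0 : ℝ × ℝ)‖
    rw [e1, sub_zero, sub_zero, Prod.norm_mk, norm_zero, max_eq_right (norm_nonneg _)]
  set K : ℝ := ξ * B / ((1 + δ) * √A) with hK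
  have hLexp : TendstoInMeasure (P 0) (fun n ω => logLR P M W Z n (c n) (t n) ω
      - (K * (statZ1 Q M W Z n (c n) ω + statZ2 δ M W Z n (c n) ω)
        - ξ ^ 2 * B ^ 2 / (2 * A * (2 * δ + 1)))) atTop fun _ => 0 := by
    have hren' : TendstoInMeasure (P 0)
        (fun n ω => -K * (statZ2 δ M W Z n (c n) ω - Y₂ n ω)) atTop fun _ => 0 := by
      rw [tendstoInMeasure_iff_norm] at hren ⊢
      intro ε hε
      have h1 := hren (ε / (|K| + 1)) (by positivity)
      refine tendsto_of_tendsto_of_tendsto_of_le_of_le tendsto_const_nhds h1 (fun _ => zero_le)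
        fun n => measure_mono fun ω hω => ?_
      change ε ≤ ‖-K * (statZ2 δ M W Z n (c n) ω - Y₂ n ω) - 0‖ at hω
      change ε / (|K| + 1) ≤ ‖statZ2 δ M W Z n (c n) ω - Y₂ n ω - 0‖
      rw [sub_zero, Real.norm_eq_abs, abs_mul, abs_neg] at hω
      rw [sub_zero, Real.norm_eq_abs, div_le_iff₀ (by positivity)]
      nlinarith [abs_nonneg (statZ2 δ M W Z n (c n) ω - Y₂ n ω)]
    refine tendstoInMeasure_zero_of_le (E := fun _ => ∅) (by simp)
      (tendstoInMeasure_zero_add hexp hren') ?_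
    filter_upwards [hdom, hηsqrt, hncA.eventually_gt_atTop 0] with n h1 h2 h3
    filter_upwards [h1.2.2, hZ1 n] with ω h4 h5 _
    refine le_of_eq (congrArg abs ?_)
    rw [h4, h5]
    have hN : 0 < (n : ℝ) * (|c n| * A) := by
      rw [← mul_assoc]; exact mul_pos h3 hA
    have hs := Real.sqrt_pos.2 hN
    have hsA := Real.sqrt_pos.2 hA
    have e1 : excSum n (fun i => V n i ω) (fun v => v ^ δ - 1 / (1 + δ))
        = excSum n (fun i => V n i ω) (fun v => v ^ δ)
          + -(1 / (1 + δ)) * excSum n (fun i => V n i ω) fun _ => 1 := by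
      rw [← excSum_const_mul, ← excSum_add]
      congr 1
      funext v
      ring
    -- By `e1` the centred sum splits: `∑ v^δ - n p / (1 + δ) = ∑ (v^δ - 1 / (1 + δ)) + (τ - n p) /
    -- (1 + δ)`. Hence both statistics carry the same factor `K`.
    have e2 : K * (Y₁ n ω + Y₂ n ω) = η n * b * (excSum n (fun i => V n i ω) (fun v => v ^ δ)
        - n * (|c n| * A) / (1 + δ)) := by
      simp only [hY₁, hY₂, e1]
      have h6 : η n = ξ * √A * (√(n * (|c n| * A)))⁻¹ := by
        rw [← h2, mul_assoc, mul_inv_cancel₀ hs.ne', mul_one]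
      have h7 : b = B / (√A * √A) := by rw [Real.mul_self_sqrt hA.le]
      rw [h6, hK, h7]
      have : 1 + δ ≠ 0 := by linarith
      field_simp
      ring
    have e3 : ξ ^ 2 * A * b ^ 2 / (2 * (2 * δ + 1)) = ξ ^ 2 * B ^ 2 / (2 * A * (2 * δ + 1)) := by
      rw [hb]
      field_simp
    rw [← e2, e3]
    ring
  have hlaw : TendstoInDistribution (fun n => logLR P M W Z n (c n) (t n)) atTop id
      (fun _ => P 0) (gaussianReal (-(ξ ^ 2 * B ^ 2 / (2 * A * (2 * δ + 1))))
        (ξ ^ 2 * B ^ 2 / (A * (2 * δ + 1))).toNNReal) := by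
    have h1 := hjoint.continuous_comp
      (g := fun z : ℝ × ℝ => K * (z.1 + z.2) - ξ ^ 2 * B ^ 2 / (2 * A * (2 * δ + 1)))
      (by fun_prop)
    have h2 := tendstoInDistribution_congr_limit h1 (Y₂ := id)
      (μ₂ := gaussianReal (-(ξ ^ 2 * B ^ 2 / (2 * A * (2 * δ + 1))))
        (ξ ^ 2 * B ^ 2 / (A * (2 * δ + 1))).toNNReal) aemeasurable_id (by
        rw [Function.comp_id, map_prod_gaussianReal, Measure.map_id]
        congr 2
        -- The variances add up through `1 + δ² / (2 δ + 1) = (1 + δ)² / (2 δ + 1)`, which cancels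
        -- the `(1 + δ)²` in `K²`.
        rw [Real.coe_toNNReal _ (by positivity), hK, div_pow, mul_pow, mul_pow, Real.sq_sqrt hA.le]
        have : 1 + δ ≠ 0 := by linarith
        field_simp
        ring)
    refine tendstoInDistribution_of_tendstoInMeasure_sub _ _ h2 hLexp fun n => ?_
    refine (measurable_llr _ _).comp_aemeasurable ?_
    refine AEMeasurable.congr (Measurable.aemeasurable ?_)
      (hS.pointProcess_ae_eq hQ hH hM (hcneg n) h0 n).symm
    exact (measurable_pointMeasure n).comp (measurable_pi_lambda _ (harr.measurable n))
  refine ⟨hdom.mono fun n hn => ⟨hn.1, hn.2.1⟩, hLexp, hlaw, ?_, ?_, hjoint⟩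
  · refine tendstoInDistribution_congr_limit (hjoint.continuous_comp continuous_fst)
      aemeasurable_id ?_
    rw [Function.comp_id, Measure.map_id]
    exact Measure.fst_prod
  · refine tendstoInDistribution_congr_limit (hjoint.continuous_comp continuous_snd)
      aemeasurable_id ?_
    rw [Function.comp_id, Measure.map_id]
    exact Measure.snd_prod
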